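/- Let $\Gamma_1$ be a triangle and, for $n\ge 1$, let $\Gamma_{n+1}$ be the Sierpiński graph obtained from three copies of $\Gamma_n$ (placed at the top, on the left and on the right) by identifying, for each two of the copies, one outmost vertex of the one with one outmost vertex of the other, as in the usual picture of the Sierpiński gasket; the outmost (upmost, leftmost, rightmost) vertices of $\Gamma_{n+1}$ are the upmost vertex of the top copy, the leftmost vertex of the left copy and the rightmost vertex of the right copy. For a graph $A$ with $k(A)$ connected components put $r(A)=|V(A)|-k(A)$ and $n(A)=|E(A)|-r(A)$. Let $$T_n(x,y)=\sum_{A}(x-1)^{r(\Gamma_n)-r(A)}(y-1)^{n(A)}\in\mathbb Z[x,y]$$ be the Tutte polynomial of $\Gamma_n$, the sum running over all spanning subgraphs $A$ of $\Gamma_n$. Let $T_{2,n}(x,y)$ be the same sum restricted to those $A$ in which the three outmost vertices lie in one connected component, let $T_{0,n}(x,y)$ be the same sum restricted to those $A$ in which they lie in three different components, and, for each outmost vertex $c$, consider the same sum restricted to those $A$ in which the two other outmost vertices lie in one component and $c$ lies in a different one. **Proposition.** For every $n\ge 1$ the last sum does not depend on $c$; denote it by $T_{1,n}(x,y)$. There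 are unique $N_n,M_n\in\mathbb Z[x,y]$ with $$T_{1,n}(x,y)=(x-1)N_n(x,y),\qquad T_{0,n}(x,y)=(x-1)^2M_n(x,y).$$ The number of acyclic orientations of $\Gamma_n$ (orientations without directed cycles) is $T_n(2,0)$, and for every $n\ge 1$ $$T_{n+1}(2,0)=T_n(2,0)^3-2\bigl(T_{2,n}(2,0)+N_n(2,0)\bigr)^3,$$ where, with $T_{2,n},N_n,M_n$ on the right-hand sides evaluated at $(2,0)$, $$T_{2,n+1}(2,0)=-T_{2,n}^3+6T_{2,n}^2N_n+3T_{2,n}N_n^2,$$ $$N_{n+1}(2,0)=-T_{2,n}^2N_n+T_{2,n}^2M_n+7T_{2,n}N_n^2+2T_{2,n}N_nM_n+4N_n^3+N_n^2M_n,$$ $$M_{n+1}(2,0)=-3T_{2,n}N_n^2+12T_{2,n}N_nM_n+3T_{2,n}M_n^2+13N_n^3+24N_n^2M_n+9N_nM_n^2+M_n^3,$$ with initial conditions $$T_{2,1}(2,0)=2,\qquad N_1(2,0)=M_1(2,0)=1.$$ -/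

import Mathlib

namespace SierpinskiTutte

open MvPolynomial

section Tutte

variable {V : Type*} [Fintype V]

/-- The rank `r(A) = |V(A)| - k(A)`, where `k(A)` is the number of connected components.
The subtraction does not truncate, since `k(A) ≤ |V(A)|`. -/
noncomputable def rank (A : SimpleGraph V) : ℕ :=
  Fintype.card V - Nat.card A.ConnectedComponent

/-- The nullity `n(A) = |E(A)| - r(A)`.
The subtraction does not truncate, since a spanning forest of `A` has `r(A)` edges. -/
noncomputable def nullity (A : SimpleGraph V) : ℕ :=
  A.edgeSet.ncard - rank A

open Classical in
/-- The finite set of all spanning subgraphs `A` of `G`: the graphs `A` on the same vertex set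
all of whose edges are edges of `G`. -/
noncomputable def spanningSubgraphs (G : SimpleGraph V) : Finset (SimpleGraph V) :=
  Finset.univ.filter (fun A => A ≤ G)

/-- The term `(x - 1) ^ (r(G) - r(A)) * (y - 1) ^ n(A)` in `ℤ[x, y]`, with `x = X 0`, `y = X 1`.
The subtraction does not truncate when `A` is a spanning subgraph of `G`. -/
noncomputable def weight (G A : SimpleGraph V) : MvPolynomial (Fin 2) ℤ :=
  (X 0 - 1) ^ (rank G - rank A) * (X 1 - 1) ^ nullity A

/-- The Tutte polynomial `T(G; x, y)`, as a sum over all spanning subgraphs. -/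
noncomputable def tutte (G : SimpleGraph V) : MvPolynomial (Fin 2) ℤ :=
  ∑ A ∈ spanningSubgraphs G, weight G A

/-- `D` is an acyclic orientation of `G`: every arc of `D` lies on an edge of `G`, every edge
of `G` carries exactly one of its two directions, and `D` has no directed cycle. -/
structure IsAcyclicOrientation (G : SimpleGraph V) (D : V → V → Prop) : Prop where
  adj_of_arc : ∀ u v, D u v → G.Adj u v
  xor_of_adj : ∀ u v, G.Adj u v → Xor (D u v) (D v u)
  acyclic : ∀ v, ¬ Relation.TransGen D v v

/-- The number of acyclic orientations of `G`. -/
noncomputable def numAcyclicOrientations (G : SimpleGraph V) : ℕ :=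
  {D : V → V → Prop | IsAcyclicOrientation G D}.ncard

end Tutte

/-- Vertex sets in oblique lattice coordinates; `vertexSet k` is the vertex set of `Γ_(k+1)`.
It starts with an elementary triangle. At each step three translates of the previous set
(a triangle of side `2 ^ k`) are put together, consecutive ones sharing a corner. -/
def vertexSet : ℕ → Finset (ℕ × ℕ)
  | 0 => {(0, 0), (1, 0), (0, 1)}
  | k + 1 => vertexSet k ∪ (vertexSet k).map (addRightEmbedding (2 ^ k, 0)) ∪
      (vertexSet k).map (addRightEmbedding (0, 2 ^ k))

/-- The edges of `Γ_(k+1)`, as a graph on the ambient lattice: a complete graph on the three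
vertices of the elementary triangle, then the union of the three translated copies. -/
def latticeGraph : ℕ → SimpleGraph (ℕ × ℕ)
  | 0 => SimpleGraph.fromRel (fun p q => p ∈ vertexSet 0 ∧ q ∈ vertexSet 0)
  | k + 1 => latticeGraph k ⊔ (latticeGraph k).map (addRightEmbedding (2 ^ k, 0)) ⊔
      (latticeGraph k).map (addRightEmbedding (0, 2 ^ k))

/-- The vertices of the Sierpinski graph `Γ_n`, for `n ≥ 1` (by convention `Γ_0` is `Γ_1`). -/
abbrev Vertex (n : ℕ) : Type := {p : ℕ × ℕ // p ∈ vertexSet (n - 1)}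

/-- The Sierpinski graph `Γ_n`, for `n ≥ 1`: `Γ_1` is a triangle, and `Γ_(n+1)` consists of
three copies of `Γ_n`, each two of which share one corner. -/
def Gamma (n : ℕ) : SimpleGraph (Vertex n) :=
  (latticeGraph (n - 1)).comap Subtype.val

/-- The three corners of `vertexSet k`: left (`0`), right (`1`) and top (`2`). -/
def cornerPoint (k : ℕ) : Fin 3 → ℕ × ℕ :=
  ![(0, 0), (2 ^ k, 0), (0, 2 ^ k)]

theorem cornerPoint_mem (k : ℕ) : ∀ i : Fin 3, cornerPoint k i ∈ vertexSet k := by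
  induction k with
  | zero => decide
  | succ k ih =>
    have h0 := ih 0
    have h1 := ih 1
    have h2 := ih 2
    simp only [vertexSet, Finset.mem_union, Finset.mem_map]
    intro i
    fin_cases i
    · exact Or.inl (Or.inl h0)
    · exact Or.inl (Or.inr ⟨_, h1, by simp [cornerPoint, pow_succ, mul_two]⟩)
    · exact Or.inr ⟨_, h2, by simp [cornerPoint, pow_succ, mul_two]⟩

/-- The outmost vertices of `Γ_n`: leftmost (`0`), rightmost (`1`), upmost (`2`). -/
def corner (n : ℕ) (i : Fin 3) : Vertex n :=
  ⟨cornerPoint (n - 1) i, cornerPoint_mem (n - 1) i⟩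

open Classical in
/-- The set `D_(2,n)` of the spanning subgraphs of `Γ_n` in which the three outmost vertices
belong to the same connected component. -/
noncomputable def D2 (n : ℕ) : Finset (SimpleGraph (Vertex n)) :=
  (spanningSubgraphs (Gamma n)).filter
    (fun A => ∀ i j : Fin 3, A.Reachable (corner n i) (corner n j))

open Classical in
/-- The set of the spanning subgraphs of `Γ_n` in which the two outmost vertices other than
the `c`-th one belong to the same connected component, and the `c`-th one does not belong
to it. So `c = 0, 1, 2` gives `D_(1,n)^l`, `D_(1,n)^r`, `D_(1,n)^u`. -/
noncomputable def D1 (n : ℕ) (c : Fin 3) : Finset (SimpleGraph (Vertex n)) :=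
  (spanningSubgraphs (Gamma n)).filter
    (fun A => (∀ i j : Fin 3, i ≠ c → j ≠ c → A.Reachable (corner n i) (corner n j)) ∧
      ∀ i : Fin 3, i ≠ c → ¬ A.Reachable (corner n i) (corner n c))

open Classical in
/-- The set `D_(0,n)` of the spanning subgraphs of `Γ_n` in which the three outmost vertices
belong to three different connected components. -/
noncomputable def D0 (n : ℕ) : Finset (SimpleGraph (Vertex n)) :=
  (spanningSubgraphs (Gamma n)).filter
    (fun A => ∀ i j : Fin 3, i ≠ j → ¬ A.Reachable (corner n i) (corner n j))

/-- The Tutte polynomial `T_n(x, y)` of `Γ_n`. -/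
noncomputable def T (n : ℕ) : MvPolynomial (Fin 2) ℤ := tutte (Gamma n)

/-- The polynomial `T_(2,n)(x, y)`. -/
noncomputable def T2 (n : ℕ) : MvPolynomial (Fin 2) ℤ := ∑ A ∈ D2 n, weight (Gamma n) A

/-- The polynomials `T_(1,n)^l`, `T_(1,n)^r`, `T_(1,n)^u`, for `c = 0, 1, 2`. -/
noncomputable def T1 (n : ℕ) (c : Fin 3) : MvPolynomial (Fin 2) ℤ :=
  ∑ A ∈ D1 n c, weight (Gamma n) A

/-- The polynomial `T_(0,n)(x, y)`. -/
noncomputable def T0 (n : ℕ) : MvPolynomial (Fin 2) ℤ := ∑ A ∈ D0 n, weight (Gamma n) A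

open Classical in
/-- The quotient of `p` by `d ≠ 0` if `d` divides `p` in `ℤ[x, y]`, and `0` otherwise. -/
noncomputable def exactQuotient (p d : MvPolynomial (Fin 2) ℤ) : MvPolynomial (Fin 2) ℤ :=
  if h : d ∣ p then h.choose else 0

/-- `N_n = T_(1,n)^u / (x - 1)`. -/
noncomputable def N (n : ℕ) : MvPolynomial (Fin 2) ℤ := exactQuotient (T1 n 2) (X 0 - 1)

/-- `M_n = T_(0,n) / (x - 1) ^ 2`. -/
noncomputable def M (n : ℕ) : MvPolynomial (Fin 2) ℤ := exactQuotient (T0 n) ((X 0 - 1) ^ 2)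

/-- The value of a polynomial in `ℤ[x, y]` at `(x, y) = (2, 0)`. -/
noncomputable def at20 (p : MvPolynomial (Fin 2) ℤ) : ℤ := eval ![2, 0] p

end SierpinskiTutte

/-! Sort the spanning subgraphs of `Γ_n` by the partition, one of five, that they induce on the
outmost vertices. A spanning subgraph of `Γ_(n+1)` is a triple of spanning subgraphs of `Γ_n`, and
the partitions of the triple determine the new one (`IsGluing.pattern_glue`). Edge numbers add up.
Ranks add up too, except that one is lost when each part joins the two points it shares with the
others, so that the triple closes up to a cycle (`IsGluing.rank_glue`). As `Γ_n` itself closes up,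
the five generating functions satisfy a cubic recursion: `x - 1` times the new one is a sum over
triples, where a triple that closes has the extra factor `(x - 1)(y - 1)`
(`IsGluing.patternSum_glue`). Symmetry in the corners propagates along this recursion.

Separating one or all of the corners costs one or two units of rank, hence the divisibility by `x -
1` and `(x - 1)^2`. At `(2, 0)` these factors become `1` and the closing factor becomes `-1`;
enumerating the 125 triples of partitions gives the recursions. The formula for the total is then
transparent: were every triple to count with `+1`, the sum would be `T_n^3`; the closing triples
contribute `(T_{2,n} + N_n)^3` and are counted with `-1` instead.

Stanley's theorem is proved by deletion and contraction, for orientations that stay acyclic after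
contracting a second graph `C` (`ncard_isAcyclicModulo`). Keeping `C` as a graph on the same vertex
set avoids quotients. -/

namespace SierpinskiTutte

open MvPolynomial

/-! ### Paths in a relation with one more arc. -/

section Relations

variable {α : Type*}

/-- A walk in a relation enlarged by one arc `u → v` either avoids the arc, or splits at its
first and last use of it. -/
theorem reflTransGen_insert_arc {R : α → α → Prop} {u v a b : α} :
    Relation.ReflTransGen (fun x y => R x y ∨ (x = u ∧ y = v)) a b ↔
      Relation.ReflTransGen R a b ∨
        (Relation.ReflTransGen R a u ∧ Relation.ReflTransGen R v b) := by
  constructor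
  · intro h
    induction h with
    | refl => exact Or.inl .refl
    | tail _ hs ih =>
      rcases hs with hs | ⟨rfl, rfl⟩
      · rcases ih with ih | ⟨h1, h2⟩
        · exact Or.inl (ih.tail hs)
        · exact Or.inr ⟨h1, h2.tail hs⟩
      · rcases ih with ih | ⟨h1, h2⟩
        · exact Or.inr ⟨ih, .refl⟩
        · exact Or.inr ⟨h1, .refl⟩
  · have mono : ∀ {x y}, Relation.ReflTransGen R x y →
        Relation.ReflTransGen (fun x y => R x y ∨ (x = u ∧ y = v)) x y :=
      fun h => Relation.ReflTransGen.mono (fun _ _ h => Or.inl h) _ _ h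
    rintro (h | ⟨h1, h2⟩)
    · exact mono h
    · exact ((mono h1).tail (Or.inr ⟨rfl, rfl⟩)).trans (mono h2)

end Relations

/-! ### Reachability in unions of graphs that overlap in one or two vertices. -/

section Reachability

variable {V : Type*} {G H : SimpleGraph V} {u v a b : V}

theorem reachable_sup_edge :
    (G ⊔ SimpleGraph.edge u v).Reachable a b ↔
      G.Reachable a b ∨ (G.Reachable a u ∧ G.Reachable v b) ∨
        (G.Reachable a v ∧ G.Reachable u b) := by
  have mono : ∀ {x y}, G.Reachable x y → (G ⊔ SimpleGraph.edge u v).Reachable x y :=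
    fun h => h.mono le_sup_left
  have huv : (G ⊔ SimpleGraph.edge u v).Reachable u v := by
    by_cases h : u = v
    · rw [h]
    · exact SimpleGraph.Adj.reachable (Or.inr (by simp [SimpleGraph.edge_adj, h]))
  constructor
  · rw [SimpleGraph.reachable_iff_reflTransGen]
    intro h
    induction h with
    | refl => exact Or.inl .rfl
    | @tail x y _ hs ih =>
      rcases hs with hs | hs
      · have := hs.reachable
        rcases ih with ih | ⟨h1, h2⟩ | ⟨h1, h2⟩
        · exact Or.inl (ih.trans this)
        · exact Or.inr (Or.inl ⟨h1, h2.trans this⟩)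
        · exact Or.inr (Or.inr ⟨h1, h2.trans this⟩)
      · rw [SimpleGraph.edge_adj] at hs
        rcases hs with ⟨⟨rfl, rfl⟩ | ⟨rfl, rfl⟩, _⟩
        · rcases ih with ih | ⟨h1, h2⟩ | ⟨h1, h2⟩
          · exact Or.inr (Or.inl ⟨ih, .rfl⟩)
          · exact Or.inr (Or.inl ⟨h1, .rfl⟩)
          · exact Or.inl h1
        · rcases ih with ih | ⟨h1, h2⟩ | ⟨h1, h2⟩
          · exact Or.inr (Or.inr ⟨ih, .rfl⟩)
          · exact Or.inl h1
          · exact Or.inr (Or.inr ⟨h1, .rfl⟩)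
  · rintro (h | ⟨h1, h2⟩ | ⟨h1, h2⟩)
    · exact mono h
    · exact ((mono h1).trans huv).trans (mono h2)
    · exact ((mono h1).trans huv.symm).trans (mono h2)

theorem reachable_bot_iff : (⊥ : SimpleGraph V).Reachable a b ↔ a = b :=
  SimpleGraph.reachable_bot

/-- If the supports of `G` and `H` meet only in `p`, `q`, then `H` acts on the vertices outside
its support like an edge joining `p` and `q`, or like nothing. -/
theorem reachable_sup_iff_of_support {p q x y : V} [Decidable (H.Reachable p q)]
    (h : ∀ z, z ∈ G.support → z ∈ H.support → z = p ∨ z = q)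
    (hx : x ∈ H.support → x = p ∨ x = q) (hy : y ∈ H.support → y = p ∨ y = q) :
    (G ⊔ H).Reachable x y ↔
      (G ⊔ if H.Reachable p q then SimpleGraph.edge p q else ⊥).Reachable x y := by
  set K := (if H.Reachable p q then SimpleGraph.edge p q else ⊥ : SimpleGraph V) with hK
  -- An excursion into `H` that starts at `p` or `q` and ends where `G` can take over is trivial or
  -- runs between `p` and `q`, so `K` can replace it.
  have step : ∀ s z, (s = p ∨ s = q) → (z ∈ H.support → z = p ∨ z = q) → H.Reachable s z →
      (G ⊔ K).Reachable s z := by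
    intro s z hs hz hr
    by_cases hsz : s = z
    · rw [hsz]
    have hz' : z = p ∨ z = q := by
      apply hz
      obtain ⟨w⟩ := hr.symm
      cases w with
      | nil => exact absurd rfl hsz
      | cons ha _ => exact ⟨_, ha⟩
    have key : H.Reachable p q → (G ⊔ K).Reachable p q := by
      intro hpq
      rw [hK, if_pos hpq, reachable_sup_edge]
      exact Or.inr (Or.inl ⟨.rfl, .rfl⟩)
    rcases hs with rfl | rfl <;> rcases hz' with rfl | rfl
    · rfl
    · exact key hr
    · exact (key hr.symm).symm
    · rfl
  constructor
  · intro hr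
    -- Invariant along the walk: either no excursion into `H` is pending, or one is, begun at `s`.
    -- Intermediate vertices may lie deep inside `H`, so `hy` must not enter the induction.
    have inv : ((y ∈ H.support → y = p ∨ y = q) ∧ (G ⊔ K).Reachable x y) ∨
        ∃ s, (s = p ∨ s = q) ∧ (G ⊔ K).Reachable x s ∧ H.Reachable s y := by
      clear hy
      rw [SimpleGraph.reachable_iff_reflTransGen] at hr
      induction hr with
      | refl => exact Or.inl ⟨hx, .rfl⟩
      | @tail z z' _ hs ih =>
        rcases hs with hs | hs
        · have hz : z ∈ H.support → z = p ∨ z = q := h z ⟨_, hs⟩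
          have hz' : z' ∈ H.support → z' = p ∨ z' = q := h z' ⟨_, hs.symm⟩
          have hs' : (G ⊔ K).Reachable z z' := SimpleGraph.Adj.reachable (Or.inl hs)
          rcases ih with ⟨_, ih⟩ | ⟨s, hs1, hs2, hs3⟩
          · exact Or.inl ⟨hz', ih.trans hs'⟩
          · exact Or.inl ⟨hz', (hs2.trans (step s z hs1 hz hs3)).trans hs'⟩
        · rcases ih with ⟨hz, ih⟩ | ⟨s, hs1, hs2, hs3⟩
          · exact Or.inr ⟨z, hz ⟨_, hs⟩, ih, hs.reachable⟩
          · exact Or.inr ⟨s, hs1, hs2, hs3.trans hs.reachable⟩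
    rcases inv with ⟨_, ih⟩ | ⟨s, hs1, hs2, hs3⟩
    · exact ih
    · exact hs2.trans (step s y hs1 hy hs3)
  · by_cases hpq : H.Reachable p q
    · have hpq' : (G ⊔ H).Reachable p q := hpq.mono le_sup_right
      rw [hK, if_pos hpq, reachable_sup_edge]
      rintro (h1 | ⟨h1, h2⟩ | ⟨h1, h2⟩)
      · exact h1.mono le_sup_left
      · exact ((h1.mono le_sup_left).trans hpq').trans (h2.mono le_sup_left)
      · exact ((h1.mono le_sup_left).trans hpq'.symm).trans (h2.mono le_sup_left)
    · rw [hK, if_neg hpq, sup_bot_eq]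
      exact fun h1 => h1.mono le_sup_left

theorem eq_of_reachable_of_not_mem_support (hr : G.Reachable a b) (hb : b ∉ G.support) :
    a = b := by
  obtain ⟨w⟩ := hr.symm
  cases w with
  | nil => rfl
  | cons ha _ => exact absurd ⟨_, ha⟩ hb

/-- Walks between the two sides of a union of graphs sharing one vertex `m` pass through `m`. -/
theorem reachable_sup_of_cut_vertex {m x y : V}
    (h : ∀ z, z ∈ G.support → z ∈ H.support → z = m)
    (hx : x ∈ H.support → x = m) (hy : y ∈ G.support → y = m) (hxy : x = y → x = m) :
    (G ⊔ H).Reachable x y ↔ G.Reachable x m ∧ H.Reachable m y := by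
  constructor
  · intro hr
    have inv : ((y ∈ H.support → y = m) ∧ G.Reachable x y) ∨
        (G.Reachable x m ∧ H.Reachable m y) := by
      clear hy hxy
      rw [SimpleGraph.reachable_iff_reflTransGen] at hr
      induction hr with
      | refl => exact Or.inl ⟨hx, .rfl⟩
      | @tail z z' _ hs ih =>
        rcases hs with hs | hs
        · refine Or.inl ⟨h z' ⟨_, hs.symm⟩, ?_⟩
          rcases ih with ⟨_, ih⟩ | ⟨h1, h2⟩
          · exact ih.trans hs.reachable
          · by_cases hz : z ∈ H.support
            · obtain rfl := h z ⟨_, hs⟩ hz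
              exact h1.trans hs.reachable
            · obtain rfl := eq_of_reachable_of_not_mem_support h2 hz
              exact h1.trans hs.reachable
        · rcases ih with ⟨h0, ih⟩ | ⟨h1, h2⟩
          · obtain rfl := h0 ⟨_, hs⟩
            exact Or.inr ⟨ih, hs.reachable⟩
          · exact Or.inr ⟨h1, h2.trans hs.reachable⟩
    rcases inv with ⟨_, h1⟩ | h1
    · by_cases hg : y ∈ G.support
      · obtain rfl := hy hg
        exact ⟨h1, .rfl⟩
      -- Here the walk is trivial; `hxy` rules out that it sits at a vertex other than `m`.
      · obtain rfl := eq_of_reachable_of_not_mem_support h1 hg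
        obtain rfl := hxy rfl
        exact ⟨.rfl, .rfl⟩
    · exact h1
  · rintro ⟨h1, h2⟩
    exact (h1.mono le_sup_left).trans (h2.mono le_sup_right)

theorem reachable_map_iff {W : Type*} (f : V ↪ W) :
    (G.map f).Reachable (f a) (f b) ↔ G.Reachable a b := by
  constructor
  · intro h
    have : ∀ x, (G.map f).Reachable (f a) x → ∃ c, f c = x ∧ G.Reachable a c := by
      intro x hx
      rw [SimpleGraph.reachable_iff_reflTransGen] at hx
      induction hx with
      | refl => exact ⟨a, rfl, .rfl⟩
      | tail _ hs ih =>
        obtain ⟨c, rfl, hc⟩ := ih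
        rw [SimpleGraph.map_adj] at hs
        obtain ⟨c', d, hcd, h1, rfl⟩ := hs
        obtain rfl := f.injective h1
        exact ⟨d, rfl, hc.trans hcd.reachable⟩
    obtain ⟨c, hc, hac⟩ := this _ h
    rwa [← f.injective hc]
  · exact fun h => h.map (SimpleGraph.Embedding.map f G).toHom

theorem map_sup' {W : Type*} (f : V ↪ W) : (G ⊔ H).map f = G.map f ⊔ H.map f := by
  ext x y
  simp only [SimpleGraph.map_adj, SimpleGraph.sup_adj]
  constructor
  · rintro ⟨c, d, h | h, rfl, rfl⟩
    · exact Or.inl ⟨c, d, h, rfl, rfl⟩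
    · exact Or.inr ⟨c, d, h, rfl, rfl⟩
  · rintro (⟨c, d, h, rfl, rfl⟩ | ⟨c, d, h, rfl, rfl⟩)
    · exact ⟨c, d, Or.inl h, rfl, rfl⟩
    · exact ⟨c, d, Or.inr h, rfl, rfl⟩

theorem map_edge {W : Type*} (f : V ↪ W) :
    (SimpleGraph.edge u v).map f = SimpleGraph.edge (f u) (f v) := by
  ext x y
  simp only [SimpleGraph.map_adj, SimpleGraph.edge_adj]
  constructor
  · rintro ⟨c, d, ⟨h, hne⟩, rfl, rfl⟩
    refine ⟨?_, fun e => hne (f.injective e)⟩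
    rcases h with ⟨rfl, rfl⟩ | ⟨rfl, rfl⟩ <;> simp
  · rintro ⟨⟨rfl, rfl⟩ | ⟨rfl, rfl⟩, hne⟩
    · exact ⟨u, v, ⟨Or.inl ⟨rfl, rfl⟩, fun e => hne (congrArg f e)⟩, rfl, rfl⟩
    · exact ⟨v, u, ⟨Or.inr ⟨rfl, rfl⟩, fun e => hne (congrArg f e)⟩, rfl, rfl⟩

theorem mem_support_map {W : Type*} (f : V ↪ W) {w : W} (h : w ∈ (G.map f).support) :
    w ∈ Set.range f := by
  obtain ⟨x, hx⟩ := (SimpleGraph.mem_support _).1 h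
  obtain ⟨c, _, _, rfl, _⟩ := (SimpleGraph.map_adj _ _ _ _).1 hx
  exact ⟨c, rfl⟩

end Reachability

/-! ### Rank and nullity under adding an edge and under unions. -/

section Rank

variable {V : Type*}

/-- Finite graphs are built from the empty one by adding edges. -/
theorem edge_induction [Finite V] {P : SimpleGraph V → Prop} (G : SimpleGraph V) (bot : P ⊥)
    (sup_edge : ∀ (G : SimpleGraph V) (u v : V), u ≠ v → ¬ G.Adj u v → P G →
      P (G ⊔ SimpleGraph.edge u v)) : P G := by
  induction hn : G.edgeSet.ncard generalizing G with
  | zero =>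
    rw [Set.ncard_eq_zero, SimpleGraph.edgeSet_eq_empty] at hn
    rwa [hn]
  | succ n ih =>
    obtain ⟨e, he⟩ : G.edgeSet.Nonempty := by
      rw [← Set.ncard_pos]; omega
    induction e with | _ u v
    have hadj : G.Adj u v := he
    have heq : G = (G \ SimpleGraph.edge u v) ⊔ SimpleGraph.edge u v := by
      rw [sdiff_sup_cancel]
      intro x y hxy
      rw [SimpleGraph.edge_adj] at hxy
      rcases hxy with ⟨⟨rfl, rfl⟩ | ⟨rfl, rfl⟩, _⟩
      · exact hadj
      · exact hadj.symm
    rw [heq]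
    refine sup_edge _ u v hadj.ne ?_ (ih _ ?_)
    · simp [SimpleGraph.edge_adj, hadj.ne]
    · rw [SimpleGraph.edgeSet_sdiff, SimpleGraph.edgeSet_edge_of_ne hadj.ne,
        Set.ncard_sdiff_singleton_of_mem he, hn]
      rfl

variable [Fintype V] {G H : SimpleGraph V} {u v : V}

theorem card_connectedComponent_le : Nat.card G.ConnectedComponent ≤ Fintype.card V := by
  rw [← Nat.card_eq_fintype_card]
  exact Nat.card_le_card_of_surjective G.connectedComponentMk Quot.mk_surjective

@[simp] theorem rank_bot : rank (⊥ : SimpleGraph V) = 0 := by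
  have : Nat.card (⊥ : SimpleGraph V).ConnectedComponent = Fintype.card V := by
    rw [← Nat.card_eq_fintype_card]
    refine (Nat.card_eq_of_bijective (⊥ : SimpleGraph V).connectedComponentMk
      ⟨fun a b h => ?_, Quot.mk_surjective⟩).symm
    exact reachable_bot_iff.1 (SimpleGraph.ConnectedComponent.exact h)
  rw [rank, this, Nat.sub_self]

theorem rank_sup_edge_of_reachable (h : G.Reachable u v) :
    rank (G ⊔ SimpleGraph.edge u v) = rank G := by
  have : Nat.card (G ⊔ SimpleGraph.edge u v).ConnectedComponent =
      Nat.card G.ConnectedComponent := by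
    refine (Nat.card_eq_of_bijective (SimpleGraph.ConnectedComponent.map
      (SimpleGraph.Hom.ofLE (le_sup_left : G ≤ G ⊔ SimpleGraph.edge u v))) ⟨?_, ?_⟩).symm
    · intro c d
      refine c.ind fun x => d.ind fun y hxy => ?_
      have := SimpleGraph.ConnectedComponent.exact hxy
      refine SimpleGraph.ConnectedComponent.sound ?_
      rcases reachable_sup_edge.1 this with h1 | ⟨h1, h2⟩ | ⟨h1, h2⟩
      · exact h1
      · exact (h1.trans h).trans h2
      · exact (h1.trans h.symm).trans h2
    · intro c
      refine c.ind fun x => ⟨G.connectedComponentMk x, rfl⟩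
  rw [rank, rank, this]

/-- The new edge merges two components: those of `G` other than the one of `v` biject with the
components of the larger graph. -/
theorem rank_sup_edge_of_not_reachable (h : ¬ G.Reachable u v) :
    rank (G ⊔ SimpleGraph.edge u v) = rank G + 1 := by
  set G' := G ⊔ SimpleGraph.edge u v
  have h1 : Nat.card {c : G.ConnectedComponent // c ≠ G.connectedComponentMk v} =
      Nat.card G'.ConnectedComponent := by
    refine Nat.card_eq_of_bijective (fun c => SimpleGraph.ConnectedComponent.map
      (SimpleGraph.Hom.ofLE (le_sup_left : G ≤ G')) c.1) ⟨?_, ?_⟩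
    · rintro ⟨c, hc⟩ ⟨d, hd⟩
      revert hc hd
      refine c.ind fun x => d.ind fun y hx hy hxy => ?_
      have hxy := SimpleGraph.ConnectedComponent.exact hxy
      have hx' : ¬ G.Reachable x v := fun hr => hx (SimpleGraph.ConnectedComponent.sound hr)
      have hy' : ¬ G.Reachable y v := fun hr => hy (SimpleGraph.ConnectedComponent.sound hr)
      refine Subtype.ext (SimpleGraph.ConnectedComponent.sound ?_)
      rcases reachable_sup_edge.1 hxy with h1 | ⟨h1, h2⟩ | ⟨h1, h2⟩
      · exact h1
      · exact absurd h2.symm hy'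
      · exact absurd h1 hx'
    · intro c
      refine c.ind fun x => ?_
      by_cases hx : G.Reachable x v
      · refine ⟨⟨G.connectedComponentMk u,
          fun e => h (SimpleGraph.ConnectedComponent.exact e)⟩, ?_⟩
        exact SimpleGraph.ConnectedComponent.sound
          (reachable_sup_edge.2 (Or.inr (Or.inl ⟨.rfl, hx.symm⟩)))
      · exact ⟨⟨G.connectedComponentMk x,
          fun e => hx (SimpleGraph.ConnectedComponent.exact e)⟩, rfl⟩
  have h2 : Nat.card {c : G.ConnectedComponent // c ≠ G.connectedComponentMk v} =
      Nat.card G.ConnectedComponent - 1 := by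
    classical
    have := Fintype.ofFinite G.ConnectedComponent
    rw [Nat.card_eq_fintype_card, Nat.card_eq_fintype_card]
    simp [Fintype.card_subtype_compl]
  have h3 : 0 < Nat.card G.ConnectedComponent := by
    have : Nonempty G.ConnectedComponent := ⟨G.connectedComponentMk v⟩
    exact Nat.card_pos
  have h4 := card_connectedComponent_le (G := G)
  rw [rank, rank, ← h1, h2]
  omega

theorem rank_sup_edge [Decidable (G.Reachable u v)] :
    rank (G ⊔ SimpleGraph.edge u v) = rank G + if G.Reachable u v then 0 else 1 := by
  split_ifs with h
  · exact rank_sup_edge_of_reachable h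
  · exact rank_sup_edge_of_not_reachable h

theorem rank_mono (h : G ≤ H) : rank G ≤ rank H := by
  have : Nat.card H.ConnectedComponent ≤ Nat.card G.ConnectedComponent := by
    refine Nat.card_le_card_of_surjective (SimpleGraph.ConnectedComponent.map
      (SimpleGraph.Hom.ofLE h)) fun c => ?_
    exact c.ind fun x => ⟨G.connectedComponentMk x, rfl⟩
  rw [rank, rank]
  omega

theorem ncard_edgeSet_sup_edge (hne : u ≠ v) (h : ¬ G.Adj u v) :
    (G ⊔ SimpleGraph.edge u v).edgeSet.ncard = G.edgeSet.ncard + 1 := by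
  rw [SimpleGraph.edgeSet_sup, SimpleGraph.edgeSet_edge_of_ne hne, Set.union_singleton,
    Set.ncard_insert_of_notMem (show s(u, v) ∉ G.edgeSet from h)
      (Set.toFinite _)]

theorem rank_le_ncard_edgeSet (G : SimpleGraph V) : rank G ≤ G.edgeSet.ncard := by
  induction G using edge_induction with
  | bot => simp
  | sup_edge G u v hne h ih =>
    classical
    rw [ncard_edgeSet_sup_edge hne h, rank_sup_edge]
    split_ifs <;> omega

theorem nullity_add_rank (G : SimpleGraph V) : nullity G + rank G = G.edgeSet.ncard :=
  Nat.sub_add_cancel (rank_le_ncard_edgeSet G)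

theorem rank_map {W : Type*} [Fintype W] (f : V ↪ W) (G : SimpleGraph V) :
    rank (G.map f) = rank G := by
  induction G using edge_induction with
  | bot =>
    have : (⊥ : SimpleGraph V).map f = ⊥ := by ext; simp
    rw [this, rank_bot, rank_bot]
  | sup_edge G u v hne h ih =>
    classical
    rw [map_sup', map_edge, rank_sup_edge, rank_sup_edge, ih]
    simp only [reachable_map_iff]

omit [Fintype V] in
theorem ncard_edgeSet_map {W : Type*} (f : V ↪ W) (G : SimpleGraph V) :
    (G.map f).edgeSet.ncard = G.edgeSet.ncard := by
  rw [SimpleGraph.edgeSet_map]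
  exact Set.ncard_image_of_injective _ f.sym2Map.injective

open Classical in
/-- The rank of a union of two graphs whose supports share at most two vertices `p ≠ q`. -/
theorem rank_sup_of_support {p q : V} (hpq : p ≠ q)
    (h : ∀ z, z ∈ G.support → z ∈ H.support → z = p ∨ z = q) :
    rank (G ⊔ H) + (if G.Reachable p q ∧ H.Reachable p q then 1 else 0) = rank G + rank H := by
  set K := (if G.Reachable p q then SimpleGraph.edge p q else ⊥ : SimpleGraph V) with hK
  -- Build up `H` edge by edge. For the ends of an edge of `H`, the graph `G` acts only as a link
  -- `K` between `p` and `q`, so both sides grow together.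
  have key : rank (G ⊔ H) + rank K = rank G + rank (H ⊔ K) := by
    induction H using edge_induction with
    | bot => simp
    | sup_edge H u v hne hadj ih =>
      have hH : H ≤ H ⊔ SimpleGraph.edge u v := le_sup_left
      have hs : ∀ z, z ∈ G.support → z ∈ H.support → z = p ∨ z = q :=
        fun z hz hz' => h z hz (SimpleGraph.support_mono hH hz')
      have huv : (H ⊔ SimpleGraph.edge u v).Adj u v :=
        Or.inr (by simp [SimpleGraph.edge_adj, hne])
      have hr : (H ⊔ G).Reachable u v ↔ (H ⊔ K).Reachable u v :=
        reachable_sup_iff_of_support (fun z hz hz' => hs z hz' hz)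
          (fun hu => h u hu ⟨_, huv⟩) (fun hv => h v hv ⟨_, huv.symm⟩)
      rw [← sup_assoc, sup_right_comm H, sup_comm G H, rank_sup_edge, rank_sup_edge]
      have := ih hs
      rw [sup_comm G H] at this
      by_cases huv' : (H ⊔ K).Reachable u v
      · rw [if_pos huv', if_pos (hr.2 huv')]
        omega
      · rw [if_neg huv', if_neg (mt hr.1 huv')]
        omega
  by_cases hG : G.Reachable p q
  · rw [if_pos hG] at hK
    have hrK : rank K = 1 := by
      have := rank_sup_edge (G := (⊥ : SimpleGraph V)) (u := p) (v := q)
      rw [bot_sup_eq, rank_bot, if_neg (mt reachable_bot_iff.1 hpq)] at this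
      rw [hK, this]
    rw [hrK, hK, rank_sup_edge] at key
    simp only [hG, true_and]
    split_ifs at key ⊢ <;> omega
  · rw [if_neg hG] at hK
    rw [hK, rank_bot, sup_bot_eq] at key
    simpa [hG] using key

/-- Rank is additive on unions of two graphs whose supports share at most one vertex. -/
theorem rank_sup_of_cut_vertex {m : V}
    (h : ∀ z, z ∈ G.support → z ∈ H.support → z = m) : rank (G ⊔ H) = rank G + rank H := by
  induction H using edge_induction with
  | bot => simp
  | sup_edge H u v hne hadj ih =>
    classical
    have hH : H ≤ H ⊔ SimpleGraph.edge u v := le_sup_left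
    have hs : ∀ z, z ∈ G.support → z ∈ H.support → z = m :=
      fun z hz hz' => h z hz (SimpleGraph.support_mono hH hz')
    have huv : (H ⊔ SimpleGraph.edge u v).Adj u v :=
      Or.inr (by simp [SimpleGraph.edge_adj, hne])
    have hr := reachable_sup_iff_of_support (G := H) (H := G) (p := m) (q := m) (x := u) (y := v)
      (fun z hz hz' => Or.inl (hs z hz' hz))
      (fun hu => Or.inl (h u hu ⟨_, huv⟩)) (fun hv => Or.inl (h v hv ⟨_, huv.symm⟩))
    have hm : SimpleGraph.edge m m = ⊥ := by ext; simp
    rw [hm, ite_self, sup_bot_eq] at hr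
    rw [← sup_assoc, sup_comm G H, rank_sup_edge, rank_sup_edge, ← add_assoc, ← ih hs,
      sup_comm G H]
    simp only [hr]

end Rank


/-! ### Spanning subgraphs with and without a given edge. -/

section SpanningSubgraphs

variable {V : Type*} [Fintype V] {F A : SimpleGraph V} {u v : V}

theorem mem_spanningSubgraphs : A ∈ spanningSubgraphs F ↔ A ≤ F := by
  simp [spanningSubgraphs]

omit [Fintype V] in
theorem sup_edge_sdiff_edge (h : ¬ A.Adj u v) :
    (A ⊔ SimpleGraph.edge u v) \ SimpleGraph.edge u v = A := by
  rw [sup_sdiff_right_self, SimpleGraph.sdiff_edge _ h]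

/-- The spanning subgraphs of `F + uv` are those of `F`, with or without the edge `uv`. -/
theorem sum_spanningSubgraphs_sup_edge {R : Type*} [AddCommMonoid R] (g : SimpleGraph V → R)
    (hne : u ≠ v) (h : ¬ F.Adj u v) :
    ∑ A ∈ spanningSubgraphs (F ⊔ SimpleGraph.edge u v), g A =
      ∑ A ∈ spanningSubgraphs F, (g A + g (A ⊔ SimpleGraph.edge u v)) := by
  classical
  have huv : ∀ A : SimpleGraph V, (A ⊔ SimpleGraph.edge u v).Adj u v :=
    fun A => Or.inr (by simp [SimpleGraph.edge_adj, hne])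
  have hadj : ∀ {A}, A ∈ spanningSubgraphs F → ¬ A.Adj u v :=
    fun hA h' => h (mem_spanningSubgraphs.1 hA h')
  have hunion : spanningSubgraphs (F ⊔ SimpleGraph.edge u v) =
      spanningSubgraphs F ∪ (spanningSubgraphs F).image (· ⊔ SimpleGraph.edge u v) := by
    ext A
    simp only [Finset.mem_union, Finset.mem_image, mem_spanningSubgraphs]
    constructor
    · intro hA
      by_cases hA' : A.Adj u v
      · refine Or.inr ⟨A \ SimpleGraph.edge u v, sdiff_le_iff'.2 hA, ?_⟩
        rw [sdiff_sup_cancel]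
        intro x y hxy
        rw [SimpleGraph.edge_adj] at hxy
        rcases hxy with ⟨⟨rfl, rfl⟩ | ⟨rfl, rfl⟩, _⟩
        · exact hA'
        · exact hA'.symm
      · refine Or.inl ?_
        rw [← SimpleGraph.sdiff_edge A hA']
        exact sdiff_le_iff'.2 hA
    · rintro (hA | ⟨B, hB, rfl⟩)
      · exact hA.trans le_sup_left
      · exact sup_le_sup_right hB _
  rw [hunion, Finset.sum_union, Finset.sum_add_distrib, Finset.sum_image]
  · intro A hA B hB hAB
    rw [← sup_edge_sdiff_edge (hadj hA), ← sup_edge_sdiff_edge (hadj hB)]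
    exact congrArg (· \ SimpleGraph.edge u v) hAB
  · rw [Finset.disjoint_left]
    intro A hA hA'
    obtain ⟨B, _, rfl⟩ := Finset.mem_image.1 hA'
    exact hadj hA (huv B)

theorem spanningSubgraphs_bot : spanningSubgraphs (⊥ : SimpleGraph V) = {⊥} := by
  ext A
  simp [mem_spanningSubgraphs]

end SpanningSubgraphs

/-! ### Orientations that are acyclic modulo a contracted graph. -/

section Orientations

variable {V : Type*} {C F : SimpleGraph V} {D : V → V → Prop} {u v a b : V}

/-- The steps allowed when following the arcs of `D` and the edges of `C` in both directions. -/
def Step (C : SimpleGraph V) (D : V → V → Prop) (x y : V) : Prop := D x y ∨ C.Adj x y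

/-- `D` is an orientation of `F` that becomes acyclic when the edges of `C` are contracted. -/
structure IsAcyclicModulo (C F : SimpleGraph V) (D : V → V → Prop) : Prop where
  adj_of_arc : ∀ u v, D u v → F.Adj u v
  xor_of_adj : ∀ u v, F.Adj u v → Xor (D u v) (D v u)
  acyclic : ∀ u v, D u v → ¬ Relation.ReflTransGen (Step C D) v u

/-- `D` with the additional arc `u → v`. -/
def insertArc (u v : V) (D : V → V → Prop) (x y : V) : Prop := D x y ∨ (x = u ∧ y = v)

theorem isAcyclicModulo_bot_iff {G : SimpleGraph V} :
    IsAcyclicModulo ⊥ G D ↔ IsAcyclicOrientation G D := by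
  have hstep : Step ⊥ D = D := by
    ext x y
    simp [Step]
  constructor
  · rintro ⟨h1, h2, h3⟩
    refine ⟨h1, h2, fun v hv => ?_⟩
    rw [hstep] at h3
    obtain ⟨w, hvw, hwv⟩ := Relation.TransGen.head'_iff.1 hv
    exact h3 _ _ hvw hwv
  · rintro ⟨h1, h2, h3⟩
    refine ⟨h1, h2, fun u v huv hvu => ?_⟩
    rw [hstep] at hvu
    exact h3 u (Relation.TransGen.head' huv hvu)

/-- The two paths form a closed walk, and no arc of `D` lies on a closed walk; only edges of `C`
remain. -/
theorem reachable_of_path_of_path (hD : IsAcyclicModulo C F D)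
    (hab : Relation.ReflTransGen (Step C D) a b) (hba : Relation.ReflTransGen (Step C D) b a) :
    C.Reachable a b := by
  induction hab with
  | refl => rfl
  | @tail x y hax hxy ih =>
    have hx := ih (hba.head hxy)
    rcases hxy with hxy | hxy
    · exact absurd (hba.trans hax) (hD.acyclic _ _ hxy)
    · exact hx.trans hxy.reachable

theorem path_of_reachable (h : C.Reachable a b) : Relation.ReflTransGen (Step C D) a b := by
  rw [SimpleGraph.reachable_iff_reflTransGen] at h
  exact Relation.ReflTransGen.mono (fun _ _ h => Or.inr h) _ _ h

theorem path_insertArc : Relation.ReflTransGen (Step C (insertArc u v D)) a b ↔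
    Relation.ReflTransGen (Step C D) a b ∨
      (Relation.ReflTransGen (Step C D) a u ∧ Relation.ReflTransGen (Step C D) v b) := by
  rw [← reflTransGen_insert_arc]
  have : Step C (insertArc u v D) = fun x y => Step C D x y ∨ (x = u ∧ y = v) := by
    ext x y
    simp only [Step, insertArc]
    tauto
  rw [this]

/-- Contracting an edge amounts to allowing both of its arcs, so `path_insertArc` can be applied
once per arc. -/
theorem step_sup_edge (hne : u ≠ v) : Step (C ⊔ SimpleGraph.edge u v) D =
    Step C (insertArc v u (insertArc u v D)) := by
  ext x y
  simp only [Step, insertArc, SimpleGraph.sup_adj, SimpleGraph.edge_adj]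
  constructor
  · tauto
  · rintro (((h | h) | h) | h)
    · exact Or.inl h
    · refine Or.inr (Or.inr ⟨Or.inl h, ?_⟩)
      rwa [h.1, h.2]
    · refine Or.inr (Or.inr ⟨Or.inr h, ?_⟩)
      rw [h.1, h.2]
      exact hne.symm
    · exact Or.inr (Or.inl h)

theorem isAcyclicModulo_insertArc (hne : u ≠ v) (hF : ¬ F.Adj u v)
    (huv : ¬ D u v) (hvu : ¬ D v u) :
    IsAcyclicModulo C (F ⊔ SimpleGraph.edge u v) (insertArc u v D) ↔
      IsAcyclicModulo C F D ∧ ¬ Relation.ReflTransGen (Step C D) v u := by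
  have hF' : ¬ F.Adj v u := fun h => hF h.symm
  constructor
  · rintro ⟨h1, h2, h3⟩
    refine ⟨⟨fun x y hxy => ?_, fun x y hxy => ?_, fun x y hxy hyx => ?_⟩, fun h => ?_⟩
    · rcases h1 x y (Or.inl hxy) with h | h
      · exact h
      · rw [SimpleGraph.edge_adj] at h
        rcases h with ⟨⟨rfl, rfl⟩ | ⟨rfl, rfl⟩, _⟩
        · exact absurd hxy huv
        · exact absurd hxy hvu
    · have := h2 x y (Or.inl hxy)
      have e1 : ¬ (x = u ∧ y = v) := by rintro ⟨rfl, rfl⟩; exact hF hxy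
      have e2 : ¬ (y = u ∧ x = v) := by rintro ⟨rfl, rfl⟩; exact hF' hxy
      simpa only [insertArc, e1, e2, or_false] using this
    · exact h3 x y (Or.inl hxy) (path_insertArc.2 (Or.inl hyx))
    · exact h3 u v (Or.inr ⟨rfl, rfl⟩) (path_insertArc.2 (Or.inl h))
  · rintro ⟨⟨h1, h2, h3⟩, h⟩
    refine ⟨fun x y hxy => ?_, fun x y hxy => ?_, fun x y hxy hyx => ?_⟩
    · rcases hxy with hxy | ⟨rfl, rfl⟩
      · exact Or.inl (h1 x y hxy)
      · exact Or.inr (by simp [SimpleGraph.edge_adj, hne])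
    · rcases hxy with hxy | hxy
      · have := h2 x y hxy
        have e1 : ¬ (x = u ∧ y = v) := by rintro ⟨rfl, rfl⟩; exact hF hxy
        have e2 : ¬ (y = u ∧ x = v) := by rintro ⟨rfl, rfl⟩; exact hF' hxy
        simpa only [insertArc, e1, e2, or_false] using this
      · rw [SimpleGraph.edge_adj] at hxy
        rcases hxy with ⟨⟨rfl, rfl⟩ | ⟨rfl, rfl⟩, _⟩
        · refine Or.inl ⟨Or.inr ⟨rfl, rfl⟩, ?_⟩
          rintro (h' | h')
          · exact hvu h'
          · exact hne h'.2
        · refine Or.inr ⟨Or.inr ⟨rfl, rfl⟩, ?_⟩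
          rintro (h' | h')
          · exact hvu h'
          · exact hne h'.2
    · rw [path_insertArc] at hyx
      rcases hxy with hxy | ⟨rfl, rfl⟩
      · rcases hyx with hyx | ⟨e1, e2⟩
        · exact h3 x y hxy hyx
        · exact h ((e2.tail (Or.inl hxy)).trans e1)
      · rcases hyx with hyx | ⟨e1, _⟩
        · exact h hyx
        · exact h e1

/-- A path between `u` and `v`, in either direction, contains an arc of `D` because `C` does not
connect them; the contraction puts this arc on a cycle. Conversely a new cycle through an arc, cut
at the contracted edge, yields such a path or an old cycle. -/
theorem isAcyclicModulo_sup_edge (hne : u ≠ v) (hC : ¬ C.Reachable u v) :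
    IsAcyclicModulo (C ⊔ SimpleGraph.edge u v) F D ↔
      IsAcyclicModulo C F D ∧ ¬ Relation.ReflTransGen (Step C D) v u ∧
        ¬ Relation.ReflTransGen (Step C D) u v := by
  have key : ∀ {a b}, Relation.ReflTransGen (Step C D) a b → ¬ C.Reachable a b →
      ∃ x y, D x y ∧ Relation.ReflTransGen (Step C D) a x ∧
        Relation.ReflTransGen (Step C D) y b := by
    intro a b hab
    induction hab with
    | refl => exact fun h => absurd .rfl h
    | @tail x y hax hxy ih =>
      intro hay
      rcases hxy with hxy | hxy
      · exact ⟨x, y, hxy, hax, .refl⟩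
      · obtain ⟨p, q, hpq, h1, h2⟩ := ih fun hr => hay (hr.trans hxy.reachable)
        exact ⟨p, q, hpq, h1, h2.tail (Or.inr hxy)⟩
  have path_iff : ∀ {a b}, Relation.ReflTransGen (Step (C ⊔ SimpleGraph.edge u v) D) a b ↔ _ :=
    fun {a b} => by
      rw [step_sup_edge hne, path_insertArc, path_insertArc, path_insertArc, path_insertArc]
  constructor
  · rintro ⟨h1, h2, h3⟩
    refine ⟨⟨h1, h2, fun x y hxy hyx => h3 x y hxy (path_iff.2 (Or.inl (Or.inl hyx)))⟩,
      fun h => ?_, fun h => ?_⟩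
    · obtain ⟨x, y, hxy, e1, e2⟩ := key h fun hr => hC hr.symm
      exact h3 x y hxy (path_iff.2 (Or.inl (Or.inr ⟨e2, e1⟩)))
    · obtain ⟨x, y, hxy, e1, e2⟩ := key h hC
      exact h3 x y hxy (path_iff.2 (Or.inr ⟨Or.inl e2, Or.inl e1⟩))
  · rintro ⟨⟨h1, h2, h3⟩, hvu, huv⟩
    refine ⟨h1, h2, fun x y hxy hyx => ?_⟩
    have arc : ∀ {a b}, Relation.ReflTransGen (Step C D) a x →
        Relation.ReflTransGen (Step C D) y b → Relation.ReflTransGen (Step C D) a b :=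
      fun e1 e2 => (e1.tail (Or.inl hxy)).trans e2
    rcases path_iff.1 hyx with (h | ⟨e1, e2⟩) | ⟨e1 | ⟨e1, e1'⟩, e2 | ⟨e2, e2'⟩⟩
    · exact h3 x y hxy h
    · exact hvu (arc e2 e1)
    · exact huv (arc e2 e1)
    · exact h3 x y hxy (e1.trans e2')
    · exact h3 x y hxy (e1.trans e2)
    · exact hvu (arc e2' e1)

end Orientations

/-! ### Stanley's theorem by deletion and contraction. -/

section Stanley

variable {V : Type*} [Fintype V] {C F : SimpleGraph V} {u v : V}

theorem ncard_isAcyclicModulo_sup_edge_of_reachable (hne : u ≠ v) (hC : C.Reachable u v) :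
    {D | IsAcyclicModulo C (F ⊔ SimpleGraph.edge u v) D}.ncard = 0 := by
  rw [Set.ncard_eq_zero]
  refine Set.eq_empty_of_forall_notMem fun D hD => ?_
  have huv : (F ⊔ SimpleGraph.edge u v).Adj u v := Or.inr (by simp [SimpleGraph.edge_adj, hne])
  rcases hD.xor_of_adj u v huv with ⟨h, _⟩ | ⟨h, _⟩
  · exact hD.acyclic _ _ h (path_of_reachable hC.symm)
  · exact hD.acyclic _ _ h (path_of_reachable hC)

/-- Deletion and contraction of an edge. -/
theorem ncard_isAcyclicModulo_sup_edge_of_not_reachable (hne : u ≠ v) (hF : ¬ F.Adj u v)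
    (hC : ¬ C.Reachable u v) :
    {D | IsAcyclicModulo C (F ⊔ SimpleGraph.edge u v) D}.ncard =
      {D | IsAcyclicModulo C F D}.ncard +
        {D | IsAcyclicModulo (C ⊔ SimpleGraph.edge u v) F D}.ncard := by
  -- The orientations of `F` that can be extended by `u → v`, respectively by `v → u`. Each
  -- admissible one extends in at least one way, and those that extend in both ways are the ones of
  -- the contraction; the count is `|S₁| + |S₂| = |S₁ ∪ S₂| + |S₁ ∩ S₂|`.
  set S₁ := {D | IsAcyclicModulo C F D ∧ ¬ Relation.ReflTransGen (Step C D) v u} with hS₁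
  set S₂ := {D | IsAcyclicModulo C F D ∧ ¬ Relation.ReflTransGen (Step C D) u v} with hS₂
  have hF' : ¬ F.Adj v u := fun h => hF h.symm
  have no_arc : ∀ {D}, IsAcyclicModulo C F D → ¬ D u v ∧ ¬ D v u :=
    fun hD => ⟨fun h => hF (hD.adj_of_arc _ _ h), fun h => hF' (hD.adj_of_arc _ _ h)⟩
  have hunion : S₁ ∪ S₂ = {D | IsAcyclicModulo C F D} := by
    ext D
    simp only [hS₁, hS₂, Set.mem_union, Set.mem_ofPred_eq]
    constructor
    · rintro (h | h) <;> exact h.1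
    · intro hD
      by_cases hvu : Relation.ReflTransGen (Step C D) v u
      · exact Or.inr ⟨hD, fun huv => hC (reachable_of_path_of_path hD huv hvu)⟩
      · exact Or.inl ⟨hD, hvu⟩
  have hinter : S₁ ∩ S₂ = {D | IsAcyclicModulo (C ⊔ SimpleGraph.edge u v) F D} := by
    ext D
    simp only [hS₁, hS₂, Set.mem_inter_iff, Set.mem_ofPred_eq, isAcyclicModulo_sup_edge hne hC]
    tauto
  have remove : ∀ {D : V → V → Prop} {x y : V}, D x y →
      insertArc x y (fun a b => D a b ∧ ¬ (a = x ∧ b = y)) = D := by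
    intro D x y hxy
    ext a b
    simp only [insertArc]
    constructor
    · rintro (h | ⟨rfl, rfl⟩)
      · exact h.1
      · exact hxy
    · intro h
      by_cases hab : a = x ∧ b = y
      · exact Or.inr hab
      · exact Or.inl ⟨h, hab⟩
  have himage : {D | IsAcyclicModulo C (F ⊔ SimpleGraph.edge u v) D} =
      insertArc u v '' S₁ ∪ insertArc v u '' S₂ := by
    ext D
    simp only [Set.mem_union, Set.mem_image, Set.mem_ofPred_eq]
    constructor
    · intro hD
      have huv : (F ⊔ SimpleGraph.edge u v).Adj u v :=
        Or.inr (by simp [SimpleGraph.edge_adj, hne])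
      rcases hD.xor_of_adj u v huv with ⟨h, h'⟩ | ⟨h, h'⟩
      · refine Or.inl ⟨_, ?_, remove h⟩
        rw [← remove h] at hD
        exact (isAcyclicModulo_insertArc hne hF (by simp) (fun e => h' e.1)).1 hD
      · refine Or.inr ⟨_, ?_, remove h⟩
        rw [← remove h, SimpleGraph.edge_comm] at hD
        exact (isAcyclicModulo_insertArc hne.symm hF' (by simp) (fun e => h' e.1)).1 hD
    · rintro (⟨D, hD, rfl⟩ | ⟨D, hD, rfl⟩)
      · obtain ⟨h1, h2⟩ := no_arc hD.1
        exact (isAcyclicModulo_insertArc hne hF h1 h2).2 hD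
      · obtain ⟨h1, h2⟩ := no_arc hD.1
        rw [SimpleGraph.edge_comm]
        exact (isAcyclicModulo_insertArc hne.symm hF' h2 h1).2 hD
  have inj : ∀ {x y : V} {S : Set (V → V → Prop)}, (∀ D ∈ S, ¬ D x y) →
      Set.InjOn (insertArc x y) S := by
    intro x y S hS D hD D' hD' h
    ext a b
    have hab := congrFun (congrFun h a) b
    simp only [insertArc, eq_iff_iff] at hab
    by_cases e : a = x ∧ b = y
    · obtain ⟨rfl, rfl⟩ := e
      exact iff_of_false (hS D hD) (hS D' hD')
    · simpa only [e, or_false] using hab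
  have hdisj : Disjoint (insertArc u v '' S₁) (insertArc v u '' S₂) := by
    rw [Set.disjoint_left]
    rintro _ ⟨D, hD, rfl⟩ ⟨D', hD', h⟩
    have : insertArc v u D' u v := by
      rw [h]
      exact Or.inr ⟨rfl, rfl⟩
    rcases this with h | h
    · exact (no_arc hD'.1).1 h
    · exact hne h.1
  rw [himage, Set.ncard_union_eq hdisj (Set.toFinite _) (Set.toFinite _),
    (inj fun D hD => (no_arc hD.1).1).ncard_image,
    (inj fun D hD => (no_arc hD.1).2).ncard_image, ← hunion, ← hinter,
    Set.ncard_union_add_ncard_inter _ _ (Set.toFinite _) (Set.toFinite _)]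

/-- The rank of `A` after contracting `C` is `rank (A ⊔ C) - rank C`; only its parity matters, hence
the plus sign. If `C` already joins `u` and `v`, the terms with and without the edge cancel;
otherwise they are the terms of the contraction and the deletion. -/
theorem ncard_isAcyclicModulo (C F : SimpleGraph V) :
    ({D | IsAcyclicModulo C F D}.ncard : ℤ) =
      ∑ A ∈ spanningSubgraphs F, (-1) ^ (A.edgeSet.ncard + rank (A ⊔ C) + rank C) := by
  induction F using edge_induction generalizing C with
  | bot =>
    have : {D | IsAcyclicModulo C (⊥ : SimpleGraph V) D} = {fun _ _ => False} := by
      ext D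
      simp only [Set.mem_ofPred_eq, Set.mem_singleton_iff]
      constructor
      · rintro ⟨h1, -, -⟩
        ext x y
        exact ⟨fun h => h1 x y h, False.elim⟩
      · rintro rfl
        exact ⟨fun _ _ h => h.elim, fun _ _ h => h.elim, fun _ _ h => h.elim⟩
    rw [this, Set.ncard_singleton, spanningSubgraphs_bot, Finset.sum_singleton, bot_sup_eq]
    simp [← two_mul]
  | sup_edge F u v hne hF ih =>
    have hadj : ∀ {A}, A ∈ spanningSubgraphs F → ¬ A.Adj u v :=
      fun hA h' => hF (mem_spanningSubgraphs.1 hA h')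
    rw [sum_spanningSubgraphs_sup_edge _ hne hF]
    by_cases hC : C.Reachable u v
    · rw [ncard_isAcyclicModulo_sup_edge_of_reachable hne hC, Finset.sum_eq_zero]
      · rfl
      intro A hA
      rw [ncard_edgeSet_sup_edge hne (hadj hA), sup_right_comm,
        rank_sup_edge_of_reachable (hC.mono le_sup_right)]
      ring
    · rw [ncard_isAcyclicModulo_sup_edge_of_not_reachable hne hF hC, Nat.cast_add, ih, ih,
        ← Finset.sum_add_distrib]
      refine Finset.sum_congr rfl fun A hA => ?_
      rw [ncard_edgeSet_sup_edge hne (hadj hA), sup_right_comm, ← sup_assoc,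
        rank_sup_edge_of_not_reachable hC]
      ring

/-- Stanley's theorem on the number of acyclic orientations. -/
theorem numAcyclicOrientations_eq (G : SimpleGraph V) :
    (numAcyclicOrientations G : ℤ) = at20 (tutte G) := by
  have h : {D | IsAcyclicOrientation G D} = {D | IsAcyclicModulo ⊥ G D} := by
    ext D
    exact isAcyclicModulo_bot_iff.symm
  rw [numAcyclicOrientations, h, ncard_isAcyclicModulo, at20, tutte, map_sum]
  refine Finset.sum_congr rfl fun A _ => ?_
  -- Edges plus rank is nullity plus twice the rank, so the sign is `(-1) ^ nullity A`, the weight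
  -- at `(2, 0)`.
  rw [sup_bot_eq, rank_bot, add_zero, ← nullity_add_rank A, add_assoc, ← two_mul, pow_add,
    pow_mul]
  simp [weight]

end Stanley


/-! ### Gluing three copies of a graph at their corners. -/

section Gluing

variable {V W : Type*}

/-- `f` embeds three copies of `V`, marked by three corners `c`, in `W`, so that the `i`-th and
the `j`-th copy share exactly one point: the `j`-th corner of the `i`-th copy, which is the `i`-th
corner of the `j`-th copy. -/
structure IsGluing (c : Fin 3 → V) (f : Fin 3 → V ↪ W) : Prop where
  injective : Function.Injective c
  comm : ∀ i j, f i (c j) = f j (c i)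
  eq_corner : ∀ i j, i ≠ j → ∀ v w, f i v = f j w → v = c j

/-- The union of three graphs placed on the three copies. -/
def glue (f : Fin 3 → V ↪ W) (A : Fin 3 → SimpleGraph V) : SimpleGraph W :=
  ⨆ i, (A i).map (f i)

variable {c : Fin 3 → V} {f : Fin 3 → V ↪ W} {A : Fin 3 → SimpleGraph V}

theorem glue_eq_sup {i j k : Fin 3} (hij : i ≠ j) (hik : i ≠ k) (hjk : j ≠ k) :
    glue f A = (A i).map (f i) ⊔ (A j).map (f j) ⊔ (A k).map (f k) := by
  have : ∀ i j k l : Fin 3, i ≠ j → i ≠ k → j ≠ k → l = i ∨ l = j ∨ l = k := by decide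
  apply le_antisymm
  · refine iSup_le fun l => ?_
    rcases this i j k l hij hik hjk with rfl | rfl | rfl
    · exact le_sup_left.trans le_sup_left
    · exact le_sup_right.trans le_sup_left
    · exact le_sup_right
  · exact sup_le (sup_le (le_iSup (fun l => (A l).map (f l)) i)
      (le_iSup (fun l => (A l).map (f l)) j)) (le_iSup (fun l => (A l).map (f l)) k)

theorem glue_adj {x y : W} :
    (glue f A).Adj x y ↔ ∃ i a b, (A i).Adj a b ∧ f i a = x ∧ f i b = y := by
  simp only [glue, SimpleGraph.iSup_adj, SimpleGraph.map_adj]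

namespace IsGluing

theorem eq_of_mem_support (h : IsGluing c f) {i j : Fin 3} (hij : i ≠ j) {B : SimpleGraph V}
    {v : V} (hv : f i v ∈ (B.map (f j)).support) : v = c j := by
  obtain ⟨w, hw⟩ := mem_support_map _ hv
  exact h.eq_corner i j hij v w hw.symm

theorem eq_of_mem_support_inter (h : IsGluing c f) {i j : Fin 3} (hij : i ≠ j)
    {B B' : SimpleGraph V} {z : W} (hz : z ∈ (B.map (f i)).support)
    (hz' : z ∈ (B'.map (f j)).support) : z = f i (c j) := by
  obtain ⟨w, rfl⟩ := mem_support_map _ hz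
  rw [h.eq_of_mem_support hij hz']

theorem reachable_same (h : IsGluing c f) {i j : Fin 3} (hij : i ≠ j) {B B' : SimpleGraph V}
    {v w : V} : (B.map (f i) ⊔ B'.map (f j)).Reachable (f i v) (f i w) ↔ B.Reachable v w := by
  classical
  rw [reachable_sup_iff_of_support (p := f i (c j)) (q := f i (c j))]
  · have hm : SimpleGraph.edge (f i (c j)) (f i (c j)) = ⊥ := by ext; simp
    rw [hm, ite_self, sup_bot_eq, reachable_map_iff]
  · exact fun z hz hz' => Or.inl (h.eq_of_mem_support_inter hij hz hz')
  · exact fun hv => Or.inl (congrArg _ (h.eq_of_mem_support hij hv))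
  · exact fun hv => Or.inl (congrArg _ (h.eq_of_mem_support hij hv))

theorem reachable_cross (h : IsGluing c f) {i j : Fin 3} (hij : i ≠ j) {B B' : SimpleGraph V}
    {v w : V} : (B.map (f i) ⊔ B'.map (f j)).Reachable (f i v) (f j w) ↔
      B.Reachable v (c j) ∧ B'.Reachable (c i) w := by
  rw [reachable_sup_of_cut_vertex (m := f i (c j)), reachable_map_iff, h.comm i j,
    reachable_map_iff]
  · exact fun z hz hz' => h.eq_of_mem_support_inter hij hz hz'
  · exact fun hv => congrArg _ (h.eq_of_mem_support hij hv)
  · intro hw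
    rw [h.eq_of_mem_support hij.symm hw, h.comm]
  · exact fun e => congrArg _ (h.eq_corner i j hij _ _ e)

theorem eq_or_eq_of_mem_support (h : IsGluing c f) {i j k : Fin 3} (hik : i ≠ k) (hjk : j ≠ k)
    {B₁ B₂ B₃ : SimpleGraph V} {z : W} (hz : z ∈ (B₁.map (f i) ⊔ B₂.map (f j)).support)
    (hz' : z ∈ (B₃.map (f k)).support) : z = f i (c k) ∨ z = f j (c k) := by
  obtain ⟨y, hy | hy⟩ := (SimpleGraph.mem_support _).1 hz
  · exact Or.inl (h.eq_of_mem_support_inter hik ⟨_, hy⟩ hz')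
  · exact Or.inr (h.eq_of_mem_support_inter hjk ⟨_, hy⟩ hz')

/-- Connections between the outmost corners of a gluing. -/
theorem reachable_corner (h : IsGluing c f) {i j k : Fin 3} (hij : i ≠ j) (hik : i ≠ k)
    (hjk : j ≠ k) : (glue f A).Reachable (f i (c i)) (f j (c j)) ↔
      ((A i).Reachable (c i) (c j) ∧ (A j).Reachable (c i) (c j)) ∨
      ((A i).Reachable (c i) (c k) ∧ (A k).Reachable (c i) (c j) ∧
        (A j).Reachable (c k) (c j)) := by
  classical
  have hH : ((A k).map (f k)).Reachable (f i (c k)) (f j (c k)) ↔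
      (A k).Reachable (c i) (c j) := by
    rw [h.comm i k, h.comm j k, reachable_map_iff]
  have hxy : ∀ v w, ((A i).map (f i) ⊔ (A j).map (f j)).Reachable (f i v) (f j w) ↔
      (A i).Reachable v (c j) ∧ (A j).Reachable (c i) w := fun v w => h.reachable_cross hij
  have hi : ∀ v w, ((A i).map (f i) ⊔ (A j).map (f j)).Reachable (f i v) (f i w) ↔
      (A i).Reachable v w := fun v w => h.reachable_same hij
  have hj : ∀ v w, ((A i).map (f i) ⊔ (A j).map (f j)).Reachable (f j v) (f j w) ↔
      (A j).Reachable v w := fun v w => by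
    rw [sup_comm]
    exact h.reachable_same hij.symm
  -- The third copy meets the other two in two points only and acts as an edge between them, or not
  -- at all.
  rw [glue_eq_sup hij hik hjk,
    reachable_sup_iff_of_support (p := f i (c k)) (q := f j (c k))]
  · by_cases hk : (A k).Reachable (c i) (c j)
    · rw [if_pos (hH.2 hk), reachable_sup_edge, hxy, hi, hj, hxy, hxy]
      tauto
    · rw [if_neg (mt hH.1 hk), sup_bot_eq, hxy]
      tauto
  · exact fun z hz hz' => h.eq_or_eq_of_mem_support hik hjk hz hz'
  · exact fun hz => Or.inl (congrArg _ (h.eq_of_mem_support hik hz))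
  · exact fun hz => Or.inr (congrArg _ (h.eq_of_mem_support hjk hz))

/-- The three graphs close up to a cycle through the three glued points. -/
def Closes (c : Fin 3 → V) (A : Fin 3 → SimpleGraph V) : Prop :=
  (A 0).Reachable (c 1) (c 2) ∧ (A 1).Reachable (c 0) (c 2) ∧ (A 2).Reachable (c 0) (c 1)

open Classical in
-- Two copies share a cut vertex, so their ranks add; the third meets their union in two points and
-- loses one exactly when both sides connect these points.
theorem rank_glue [Fintype V] [Fintype W] (h : IsGluing c f) :
    rank (glue f A) + (if Closes c A then 1 else 0) = ∑ i, rank (A i) := by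
  have hpq : f 0 (c 2) ≠ f 1 (c 2) := fun e => by
    have := h.injective (h.eq_corner 0 1 (by decide) _ _ e)
    exact absurd this (by decide)
  have h1 := rank_sup_of_support hpq
    (fun z => h.eq_or_eq_of_mem_support (B₁ := A 0) (B₂ := A 1) (B₃ := A 2)
      (show (0 : Fin 3) ≠ 2 by decide) (show (1 : Fin 3) ≠ 2 by decide))
  have h2 := rank_sup_of_cut_vertex (m := f 0 (c 1))
    (fun z => h.eq_of_mem_support_inter (B := A 0) (B' := A 1)
      (show (0 : Fin 3) ≠ 1 by decide))
  have h3 : (((A 0).map (f 0) ⊔ (A 1).map (f 1)).Reachable (f 0 (c 2)) (f 1 (c 2)) ∧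
      ((A 2).map (f 2)).Reachable (f 0 (c 2)) (f 1 (c 2))) ↔ Closes c A := by
    rw [h.reachable_cross (by decide), h.comm 0 2, h.comm 1 2, reachable_map_iff, Closes,
      SimpleGraph.reachable_comm (u := c 2)]
    tauto
  rw [rank_map] at h1
  rw [rank_map, rank_map] at h2
  rw [glue_eq_sup (show (0 : Fin 3) ≠ 1 by decide) (show (0 : Fin 3) ≠ 2 by decide)
    (show (1 : Fin 3) ≠ 2 by decide), Fin.sum_univ_three, ← h2, ← h1]
  simp only [h3]

theorem disjoint_map (h : IsGluing c f) {i j : Fin 3} (hij : i ≠ j) (B B' : SimpleGraph V) :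
    Disjoint (B.map (f i)) (B'.map (f j)) := by
  rw [disjoint_iff_inf_le]
  rintro x y ⟨h1, h2⟩
  have hx := h.eq_of_mem_support_inter hij ⟨_, h1⟩ ⟨_, h2⟩
  have hy := h.eq_of_mem_support_inter hij ⟨_, h1.symm⟩ ⟨_, h2.symm⟩
  exact h1.ne (hx.trans hy.symm)

theorem ncard_edgeSet_glue [Fintype W] (h : IsGluing c f) :
    (glue f A).edgeSet.ncard = ∑ i, (A i).edgeSet.ncard := by
  have h01 := h.disjoint_map (show (0 : Fin 3) ≠ 1 by decide) (A 0) (A 1)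
  have h02 := h.disjoint_map (show (0 : Fin 3) ≠ 2 by decide) (A 0) (A 2)
  have h12 := h.disjoint_map (show (1 : Fin 3) ≠ 2 by decide) (A 1) (A 2)
  rw [glue_eq_sup (show (0 : Fin 3) ≠ 1 by decide) (show (0 : Fin 3) ≠ 2 by decide)
    (show (1 : Fin 3) ≠ 2 by decide), SimpleGraph.edgeSet_sup,
    Set.ncard_union_eq ?_ (Set.toFinite _) (Set.toFinite _), SimpleGraph.edgeSet_sup,
    Set.ncard_union_eq ?_ (Set.toFinite _) (Set.toFinite _), ncard_edgeSet_map,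
    ncard_edgeSet_map, ncard_edgeSet_map, Fin.sum_univ_three]
  · exact SimpleGraph.disjoint_edgeSet.2 h01
  · rw [SimpleGraph.disjoint_edgeSet, disjoint_sup_left]
    exact ⟨h02, h12⟩

open Classical in
theorem nullity_glue [Fintype V] [Fintype W] (h : IsGluing c f) :
    nullity (glue f A) = ∑ i, nullity (A i) + if Closes c A then 1 else 0 := by
  have h1 := h.rank_glue (A := A)
  have h2 := h.ncard_edgeSet_glue (A := A)
  rw [← nullity_add_rank] at h2
  simp only [← nullity_add_rank, Finset.sum_add_distrib] at h2
  omega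

open Classical in
-- Since `G` has connected corners, the full gluing closes and its rank is `3 * rank G - 1`; the
-- factor on the left makes up for this `-1`. If `A` closes as well, both corank and nullity rise by
-- one, which gives `(x - 1)(y - 1)`.
theorem weight_glue [Fintype V] [Fintype W] (h : IsGluing c f) {G : SimpleGraph V}
    (hG : ∀ i j, G.Reachable (c i) (c j)) (hA : ∀ i, A i ≤ G) :
    (X 0 - 1) * weight (glue f fun _ => G) (glue f A) =
      (if Closes c A then (X 0 - 1) * (X 1 - 1) else 1) * ∏ i, weight G (A i) := by
  have h1 := h.rank_glue (A := A)
  have h2 := h.rank_glue (A := fun _ => G)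
  rw [if_pos ⟨hG _ _, hG _ _, hG _ _⟩] at h2
  have hle : rank (glue f A) ≤ rank (glue f fun _ => G) :=
    rank_mono (iSup_mono fun i => SimpleGraph.map_monotone _ (hA i))
  have h0 := rank_mono (hA 0)
  have h0' := rank_mono (hA 1)
  have h0'' := rank_mono (hA 2)
  simp only [Fin.sum_univ_three] at h1 h2
  have hr : rank (glue f fun _ => G) - rank (glue f A) + 1 =
      (rank G - rank (A 0)) + (rank G - rank (A 1)) + (rank G - rank (A 2)) +
        if Closes c A then 1 else 0 := by
    split_ifs at h1 ⊢ <;> omega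
  rw [weight, h.nullity_glue, Fin.sum_univ_three, Fin.prod_univ_three, ← mul_assoc,
    ← pow_succ', hr]
  simp only [weight]
  split_ifs <;> ring

/-- An edge of another copy cannot have both ends in the `i`-th one, as the copies share a single
point. -/
theorem comap_glue (h : IsGluing c f) (i : Fin 3) : (glue f A).comap (f i) = A i := by
  ext x y
  rw [SimpleGraph.comap_adj, glue_adj]
  constructor
  · rintro ⟨j, a, b, hab, ha, hb⟩
    by_cases hij : i = j
    · subst hij
      rwa [← (f i).injective ha, ← (f i).injective hb]
    · have h1 := h.eq_corner j i (Ne.symm hij) _ _ ha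
      have h2 := h.eq_corner j i (Ne.symm hij) _ _ hb
      exact absurd (h1.trans h2.symm) hab.ne
  · exact fun hxy => ⟨i, x, y, hxy, rfl, rfl⟩

theorem sum_spanningSubgraphs_glue [Fintype V] [Fintype W] {R : Type*} [AddCommMonoid R]
    (h : IsGluing c f) (G : SimpleGraph V) (g : SimpleGraph W → R) :
    ∑ B ∈ spanningSubgraphs (glue f fun _ => G), g B =
      ∑ A ∈ Fintype.piFinset (fun _ : Fin 3 => spanningSubgraphs G), g (glue f A) := by
  symm
  refine Finset.sum_bij' (fun A _ => glue f A) (fun B _ i => B.comap (f i)) ?_ ?_ ?_ ?_ ?_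
  · intro A hA
    rw [mem_spanningSubgraphs]
    refine iSup_mono fun i => ?_
    exact SimpleGraph.map_monotone _ (mem_spanningSubgraphs.1 (Fintype.mem_piFinset.1 hA i))
  · intro B hB
    refine Fintype.mem_piFinset.2 fun i => mem_spanningSubgraphs.2 ?_
    rw [← h.comap_glue (A := fun _ => G) i]
    exact SimpleGraph.comap_monotone _ (mem_spanningSubgraphs.1 hB)
  · intro A _
    funext i
    exact h.comap_glue i
  · intro B hB
    ext x y
    rw [glue_adj]
    constructor
    · rintro ⟨i, a, b, hab, rfl, rfl⟩
      exact hab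
    · intro hxy
      obtain ⟨i, a, b, _, rfl, rfl⟩ := glue_adj.1 (mem_spanningSubgraphs.1 hB hxy)
      exact ⟨i, a, b, hxy, rfl, rfl⟩
  · exact fun _ _ => rfl

end IsGluing

end Gluing

/-! ### Partitions of the corners and the cubic recursion. -/

section Patterns

/-- The five partitions of three corners: `0` has one class, `4` has three classes, and
`c + 1` separates the `c`-th corner from the two others. -/
def related (t : Fin 5) (i j : Fin 3) : Bool :=
  i = j || t = 0 || (t ≠ 4 && t.val ≠ i.val + 1 && t.val ≠ j.val + 1)

theorem related_injective : ∀ t t', related t = related t' → t = t' := by decide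

variable {V : Type*}

/-- The corners `c` are connected in `A` according to the partition `t`. -/
def HasPattern (c : Fin 3 → V) (A : SimpleGraph V) (t : Fin 5) : Prop :=
  ∀ i j, A.Reachable (c i) (c j) ↔ related t i j = true

theorem HasPattern.unique {c : Fin 3 → V} {A : SimpleGraph V} {t t' : Fin 5}
    (h : HasPattern c A t) (h' : HasPattern c A t') : t = t' := by
  apply related_injective
  funext i j
  rw [Bool.eq_iff_iff, ← h, ← h']

theorem hasPattern_iff {c : Fin 3 → V} {A : SimpleGraph V} {t : Fin 5} :
    HasPattern c A t ↔ (A.Reachable (c 0) (c 1) ↔ related t 0 1 = true) ∧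
      (A.Reachable (c 0) (c 2) ↔ related t 0 2 = true) ∧
      (A.Reachable (c 1) (c 2) ↔ related t 1 2 = true) := by
  have symm : ∀ t i j, related t i j = related t j i := by decide
  have refl : ∀ t i, related t i i = true := by decide
  constructor
  · exact fun h => ⟨h _ _, h _ _, h _ _⟩
  · rintro ⟨h01, h02, h12⟩ i j
    fin_cases i <;> fin_cases j
    · exact iff_of_true .rfl (refl _ _)
    · exact h01
    · exact h02
    · rw [SimpleGraph.reachable_comm, symm]; exact h01
    · exact iff_of_true .rfl (refl _ _)
    · exact h12
    · rw [SimpleGraph.reachable_comm, symm]; exact h02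
    · rw [SimpleGraph.reachable_comm, symm]; exact h12
    · exact iff_of_true .rfl (refl _ _)

theorem exists_hasPattern (c : Fin 3 → V) (A : SimpleGraph V) : ∃ t, HasPattern c A t := by
  simp only [hasPattern_iff]
  by_cases h01 : A.Reachable (c 0) (c 1) <;> by_cases h02 : A.Reachable (c 0) (c 2)
  · have h12 := h01.symm.trans h02
    exact ⟨0, by simp [h01, h02, h12, related]⟩
  · have h12 : ¬ A.Reachable (c 1) (c 2) := fun h => h02 (h01.trans h)
    exact ⟨3, by simp only [h01, h02, h12]; decide⟩
  · have h12 : ¬ A.Reachable (c 1) (c 2) := fun h => h01 (h02.trans h.symm)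
    exact ⟨2, by simp only [h01, h02, h12]; decide⟩
  · by_cases h12 : A.Reachable (c 1) (c 2)
    · exact ⟨1, by simp only [h01, h02, h12]; decide⟩
    · exact ⟨4, by simp only [h01, h02, h12]; decide⟩

/-- The partition of the corners induced by a graph. -/
noncomputable def pattern (c : Fin 3 → V) (A : SimpleGraph V) : Fin 5 :=
  (exists_hasPattern c A).choose

theorem pattern_eq_iff {c : Fin 3 → V} {A : SimpleGraph V} {t : Fin 5} :
    pattern c A = t ↔ HasPattern c A t := by
  have h : HasPattern c A (pattern c A) := (exists_hasPattern c A).choose_spec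
  exact ⟨fun e => e ▸ h, fun h' => h.unique h'⟩

theorem reachable_iff_related (c : Fin 3 → V) (A : SimpleGraph V) (i j : Fin 3) :
    A.Reachable (c i) (c j) ↔ related (pattern c A) i j = true :=
  pattern_eq_iff.1 rfl i j

/-- Connections between the outmost corners of a gluing, in terms of the patterns of its parts. -/
def gluedRelated (τ : Fin 3 → Fin 5) (i j k : Fin 3) : Bool :=
  (related (τ i) i j && related (τ j) i j) ||
    (related (τ i) i k && related (τ k) i j && related (τ j) k j)

/-- The gluing of parts with patterns `τ` has pattern `t`. -/
def gluesTo (τ : Fin 3 → Fin 5) (t : Fin 5) : Bool :=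
  gluedRelated τ 0 1 2 = related t 0 1 && gluedRelated τ 0 2 1 = related t 0 2 &&
    gluedRelated τ 1 2 0 = related t 1 2

/-- Parts with patterns `τ` close up to a cycle through the glued points. -/
def closes (τ : Fin 3 → Fin 5) : Bool :=
  related (τ 0) 1 2 && related (τ 1) 0 2 && related (τ 2) 0 1

variable {W : Type*} {c : Fin 3 → V} {f : Fin 3 → V ↪ W}

theorem IsGluing.pattern_glue (h : IsGluing c f) (A : Fin 3 → SimpleGraph V) (t : Fin 5) :
    pattern (fun i => f i (c i)) (glue f A) = t ↔ gluesTo (fun i => pattern c (A i)) t := by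
  have hτ : ∀ τ, gluesTo τ t = true ↔ (gluedRelated τ 0 1 2 = true ↔ related t 0 1 = true) ∧
      (gluedRelated τ 0 2 1 = true ↔ related t 0 2 = true) ∧
      (gluedRelated τ 1 2 0 = true ↔ related t 1 2 = true) := fun τ => by
    simp only [gluesTo, Bool.and_eq_true, decide_eq_true_eq, and_assoc, ← Bool.eq_iff_iff]
  rw [hτ, pattern_eq_iff, hasPattern_iff,
    h.reachable_corner (i := 0) (j := 1) (k := 2) (by decide) (by decide) (by decide),
    h.reachable_corner (i := 0) (j := 2) (k := 1) (by decide) (by decide) (by decide),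
    h.reachable_corner (i := 1) (j := 2) (k := 0) (by decide) (by decide) (by decide)]
  simp only [reachable_iff_related, gluedRelated, Bool.and_eq_true, Bool.or_eq_true,
    and_assoc]

theorem closes_iff (A : Fin 3 → SimpleGraph V) :
    IsGluing.Closes c A ↔ closes (fun i => pattern c (A i)) = true := by
  simp only [IsGluing.Closes, reachable_iff_related, closes, Bool.and_eq_true, and_assoc]

/-- The part of the Tutte polynomial that belongs to the partition `t` of the corners. -/
noncomputable def patternSum [Fintype V] (c : Fin 3 → V) (G : SimpleGraph V) (t : Fin 5) :
    MvPolynomial (Fin 2) ℤ :=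
  ∑ A ∈ (spanningSubgraphs G).filter (fun A => pattern c A = t), weight G A

theorem sum_patternSum [Fintype V] (c : Fin 3 → V) (G : SimpleGraph V) :
    ∑ t, patternSum c G t = tutte G :=
  Finset.sum_fiberwise _ _ _

/-- The generating functions of a gluing, as polynomials in those of its parts. -/
theorem IsGluing.patternSum_glue [Fintype V] [Fintype W] (h : IsGluing c f)
    {G : SimpleGraph V} (hG : ∀ i j, G.Reachable (c i) (c j)) (t : Fin 5) :
    (X 0 - 1) * patternSum (fun i => f i (c i)) (glue f fun _ => G) t =
      ∑ τ : Fin 3 → Fin 5, if gluesTo τ t then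
        (if closes τ then (X 0 - 1) * (X 1 - 1) else 1) * ∏ i, patternSum c G (τ i) else 0 := by
  classical
  rw [patternSum, Finset.sum_filter, h.sum_spanningSubgraphs_glue, Finset.mul_sum,
    -- Triples are grouped by their patterns `τ`; on each group the closing factor is constant and
    -- the sum is a product of three pattern sums.
    ← Finset.sum_fiberwise _ (fun A i => pattern c (A i))]
  refine Finset.sum_congr rfl fun τ _ => ?_
  have hfilter : (Fintype.piFinset fun _ : Fin 3 => spanningSubgraphs G).filter
      (fun A => (fun i => pattern c (A i)) = τ) =
      Fintype.piFinset fun i => (spanningSubgraphs G).filter (fun A => pattern c A = τ i) := by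
    ext A
    simp only [Finset.mem_filter, Fintype.mem_piFinset, funext_iff, forall_and]
  simp only [patternSum, Finset.prod_univ_sum, Finset.mul_sum, ← hfilter]
  by_cases ht : gluesTo τ t = true
  · rw [if_pos ht]
    refine Finset.sum_congr rfl fun A hA => ?_
    rw [Finset.mem_filter, Fintype.mem_piFinset] at hA
    rw [if_pos ((h.pattern_glue A t).2 (by rw [hA.2]; exact ht)), h.weight_glue hG
      (fun i => mem_spanningSubgraphs.1 (hA.1 i))]
    simp only [closes_iff, hA.2]
  · rw [if_neg ht]
    refine Finset.sum_eq_zero fun A hA => ?_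
    rw [Finset.mem_filter] at hA
    rw [if_neg (fun e => ht (by rw [← hA.2]; exact (h.pattern_glue A t).1 e)), mul_zero]

theorem sum_fin_three_fun {ι R : Type*} [Fintype ι] [AddCommMonoid R] (g : (Fin 3 → ι) → R) :
    ∑ τ, g τ = ∑ i, ∑ j, ∑ k, g ![i, j, k] := by
  simp only [← Fintype.sum_prod_type']
  refine Fintype.sum_equiv ⟨fun τ => (τ 0, τ 1, τ 2), fun p => ![p.1, p.2.1, p.2.2],
    fun τ => ?_, fun _ => rfl⟩ _ _ fun τ => congrArg g ?_
  all_goals funext i; fin_cases i <;> rfl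

end Patterns


/-! ### The 125-term sum in closed form, for symmetric generating functions. -/

section Expansion

variable {R : Type*} [CommRing R]

/-- The right-hand side of the recursion for the generating functions `w`, with weight `e` for
a cycle through the glued points. -/
def gluedSum (e : R) (w : Fin 5 → R) (t : Fin 5) : R :=
  ∑ τ : Fin 3 → Fin 5, if gluesTo τ t then (if closes τ then e else 1) * ∏ i, w (τ i) else 0

variable (e T N M : R)

theorem gluedSum_zero : gluedSum e ![T, N, N, N, M] 0 =
    e * T ^ 3 + 6 * T ^ 2 * N + 3 * T * N ^ 2 := by
  simp +decide [gluedSum, sum_fin_three_fun, Fin.sum_univ_five, Fin.prod_univ_three]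
  ring

/-- The index `c.succ.castSucc` is the partition isolating corner `c`. That the value is free of `c`
is what propagates the symmetry. -/
theorem gluedSum_succ (c : Fin 3) : gluedSum e ![T, N, N, N, M] c.succ.castSucc =
    e * T ^ 2 * N + T ^ 2 * M + 7 * T * N ^ 2 + 2 * T * N * M + 4 * N ^ 3 + N ^ 2 * M := by
  fin_cases c <;>
  · simp +decide [gluedSum, sum_fin_three_fun, Fin.sum_univ_five, Fin.prod_univ_three]
    ring

theorem gluedSum_four : gluedSum e ![T, N, N, N, M] 4 =
    3 * e * T * N ^ 2 + 12 * T * N * M + 3 * T * M ^ 2 + (14 + e) * N ^ 3 + 24 * N ^ 2 * M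
      + 9 * N * M ^ 2 + M ^ 3 := by
  simp +decide [gluedSum, sum_fin_three_fun, Fin.sum_univ_five, Fin.prod_univ_three]
  ring

end Expansion

/-! ### The Sierpiński graphs as gluings, and the triangle. -/

section Sierpinski

theorem fst_add_snd_le {k : ℕ} {p : ℕ × ℕ} (hp : p ∈ vertexSet k) : p.1 + p.2 ≤ 2 ^ k := by
  induction k generalizing p with
  | zero =>
    revert p
    decide
  | succ k ih =>
    simp only [vertexSet, Finset.mem_union, Finset.mem_map, addRightEmbedding_apply] at hp
    rw [pow_succ]
    rcases hp with (hp | ⟨q, hq, rfl⟩) | ⟨q, hq, rfl⟩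
    · have := ih hp
      omega
    · have := ih hq
      simp only [Prod.fst_add, Prod.snd_add]
      omega
    · have := ih hq
      simp only [Prod.fst_add, Prod.snd_add]
      omega

theorem mem_vertexSet_of_adj {k : ℕ} {p q : ℕ × ℕ} (h : (latticeGraph k).Adj p q) :
    p ∈ vertexSet k ∧ q ∈ vertexSet k := by
  induction k generalizing p q with
  | zero =>
    rw [latticeGraph, SimpleGraph.fromRel_adj] at h
    tauto
  | succ k ih =>
    simp only [latticeGraph, SimpleGraph.sup_adj, SimpleGraph.map_adj] at h
    simp only [vertexSet, Finset.mem_union, Finset.mem_map]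
    rcases h with (h | ⟨a, b, h, rfl, rfl⟩) | ⟨a, b, h, rfl, rfl⟩
    · exact ⟨Or.inl (Or.inl (ih h).1), Or.inl (Or.inl (ih h).2)⟩
    · exact ⟨Or.inl (Or.inr ⟨a, (ih h).1, rfl⟩), Or.inl (Or.inr ⟨b, (ih h).2, rfl⟩)⟩
    · exact ⟨Or.inr ⟨a, (ih h).1, rfl⟩, Or.inr ⟨b, (ih h).2, rfl⟩⟩

theorem add_cornerPoint_mem {k : ℕ} (i : Fin 3) {p : ℕ × ℕ} (hp : p ∈ vertexSet k) :
    p + cornerPoint k i ∈ vertexSet (k + 1) := by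
  simp only [vertexSet, Finset.mem_union, Finset.mem_map]
  fin_cases i
  · exact Or.inl (Or.inl hp)
  · exact Or.inl (Or.inr ⟨p, hp, rfl⟩)
  · exact Or.inr ⟨p, hp, rfl⟩

/-- The `i`-th copy of `Γ_(k+1)` in `Γ_(k+2)`. -/
def copy (k : ℕ) (i : Fin 3) : Vertex (k + 1) ↪ Vertex (k + 2) where
  toFun p := ⟨p.1 + cornerPoint k i, add_cornerPoint_mem i p.2⟩
  inj' _ _ h := Subtype.ext (add_right_cancel (congrArg Subtype.val h))

/-- As copy `i` is the translate by corner `i`, `comm` is commutativity of addition. The bound `p.1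
+ p.2 ≤ 2 ^ k` keeps different copies apart except at corners. -/
theorem isGluing_copy (k : ℕ) : IsGluing (corner (k + 1)) (copy k) where
  injective i j h := by
    have h' : cornerPoint k i = cornerPoint k j := congrArg Subtype.val h
    have : 2 ^ k ≠ 0 := by positivity
    fin_cases i <;> fin_cases j <;> simp [cornerPoint] at h' ⊢ <;> omega
  comm i j := Subtype.ext (add_comm _ _)
  eq_corner i j hij v w h := by
    have h' : v.1 + cornerPoint k i = w.1 + cornerPoint k j := congrArg Subtype.val h
    have hv := fst_add_snd_le v.2
    have hw := fst_add_snd_le w.2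
    have h1 := congrArg Prod.fst h'
    have h2 := congrArg Prod.snd h'
    refine Subtype.ext (Prod.ext ?_ ?_) <;>
    · simp only [corner, Nat.add_sub_cancel] at hv hw h1 h2 ⊢
      fin_cases i <;> fin_cases j <;> simp [cornerPoint] at hij h1 h2 ⊢ <;> omega

theorem copy_corner (k : ℕ) (i : Fin 3) : copy k i (corner (k + 1) i) = corner (k + 2) i := by
  refine Subtype.ext ?_
  show cornerPoint k i + cornerPoint k i = cornerPoint (k + 1) i
  fin_cases i <;> simp [cornerPoint, pow_succ, mul_two]

theorem Gamma_succ (k : ℕ) : Gamma (k + 2) = glue (copy k) fun _ => Gamma (k + 1) := by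
  ext x y
  rw [glue_adj]
  have hx : (Gamma (k + 2)).Adj x y ↔ ((latticeGraph k).Adj x.1 y.1 ∨
      ((latticeGraph k).map (addRightEmbedding (2 ^ k, 0))).Adj x.1 y.1) ∨
      ((latticeGraph k).map (addRightEmbedding (0, 2 ^ k))).Adj x.1 y.1 := Iff.rfl
  rw [hx, SimpleGraph.map_adj, SimpleGraph.map_adj]
  constructor
  · rintro ((h | ⟨a, b, h, ha, hb⟩) | ⟨a, b, h, ha, hb⟩)
    · obtain ⟨hx, hy⟩ := mem_vertexSet_of_adj h
      exact ⟨0, ⟨x.1, hx⟩, ⟨y.1, hy⟩, h, rfl, rfl⟩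
    · obtain ⟨ha', hb'⟩ := mem_vertexSet_of_adj h
      exact ⟨1, ⟨a, ha'⟩, ⟨b, hb'⟩, h, Subtype.ext ha, Subtype.ext hb⟩
    · obtain ⟨ha', hb'⟩ := mem_vertexSet_of_adj h
      exact ⟨2, ⟨a, ha'⟩, ⟨b, hb'⟩, h, Subtype.ext ha, Subtype.ext hb⟩
  · rintro ⟨i, a, b, h, rfl, rfl⟩
    fin_cases i
    · exact Or.inl (Or.inl h)
    · exact Or.inl (Or.inr ⟨a.1, b.1, h, rfl, rfl⟩)
    · exact Or.inr ⟨a.1, b.1, h, rfl, rfl⟩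

theorem corner_one_ne : corner 1 0 ≠ corner 1 1 ∧ corner 1 0 ≠ corner 1 2 ∧
    corner 1 1 ≠ corner 1 2 :=
  ⟨(isGluing_copy 0).injective.ne (by decide), (isGluing_copy 0).injective.ne (by decide),
    (isGluing_copy 0).injective.ne (by decide)⟩

theorem Gamma_one : Gamma 1 = ⊥ ⊔ SimpleGraph.edge (corner 1 0) (corner 1 1) ⊔
    SimpleGraph.edge (corner 1 0) (corner 1 2) ⊔ SimpleGraph.edge (corner 1 1) (corner 1 2) := by
  have hsurj : ∀ x : Vertex 1, ∃ i, x = corner 1 i := by decide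
  obtain ⟨h01, h02, h12⟩ := corner_one_ne
  have hadj : ∀ x y : Vertex 1, (Gamma 1).Adj x y ↔ x ≠ y := by
    intro x y
    have hx : (Gamma 1).Adj x y ↔ x.1 ≠ y.1 ∧ (x.1 ∈ vertexSet 0 ∧ y.1 ∈ vertexSet 0 ∨
      y.1 ∈ vertexSet 0 ∧ x.1 ∈ vertexSet 0) :=
      SimpleGraph.fromRel_adj (fun p q => p ∈ vertexSet 0 ∧ q ∈ vertexSet 0) x.1 y.1
    rw [hx, ← Subtype.coe_ne_coe]
    exact ⟨fun h => h.1, fun h => ⟨h, Or.inl ⟨x.2, y.2⟩⟩⟩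
  ext x y
  rw [hadj]
  obtain ⟨i, rfl⟩ := hsurj x
  obtain ⟨j, rfl⟩ := hsurj y
  simp only [SimpleGraph.sup_adj, SimpleGraph.edge_adj, SimpleGraph.bot_adj, false_or]
  fin_cases i <;> fin_cases j <;> simp [h01, h02, h12, h01.symm, h02.symm, h12.symm]

theorem reachable_corner_Gamma (k : ℕ) (i j : Fin 3) :
    (Gamma (k + 1)).Reachable (corner (k + 1) i) (corner (k + 1) j) := by
  induction k generalizing i j with
  | zero =>
    have h : pattern (corner 1) (Gamma 1) = 0 := by
      rw [pattern_eq_iff, hasPattern_iff, Gamma_one]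
      simp [reachable_sup_edge, related]
    rw [reachable_iff_related]
    simp only [Nat.reduceAdd, h]
    revert i j
    decide
  | succ k ih =>
    by_cases hij : i = j
    · rw [hij]
    obtain ⟨l, hil, hjl⟩ : ∃ l : Fin 3, i ≠ l ∧ j ≠ l := by
      revert i j
      decide
    rw [← copy_corner, ← copy_corner, Gamma_succ,
      (isGluing_copy k).reachable_corner hij hil hjl]
    exact Or.inl ⟨ih _ _, ih _ _⟩

/-- The generating functions of `Γ_n`, by partitions of the outmost vertices. -/
noncomputable abbrev gammaSum (n : ℕ) : Fin 5 → MvPolynomial (Fin 2) ℤ :=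
  patternSum (corner n) (Gamma n)

theorem gammaSum_succ (k : ℕ) (t : Fin 5) : (X 0 - 1) * gammaSum (k + 2) t =
    gluedSum ((X 0 - 1) * (X 1 - 1)) (gammaSum (k + 1)) t := by
  have h := (isGluing_copy k).patternSum_glue (reachable_corner_Gamma k) t
  simp only [copy_corner, ← Gamma_succ] at h
  exact h

-- The eight subgraphs of the triangle: three trees and the full triangle give `3 + (y - 1)`, each
-- single edge `x - 1`, the empty graph `(x - 1)^2`.
set_option linter.unusedSimpArgs false in
theorem gammaSum_one : gammaSum 1 =
    ![X 1 + 2, X 0 - 1, X 0 - 1, X 0 - 1, (X 0 - 1) ^ 2] := by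
  classical
  obtain ⟨h01, h02, h12⟩ := corner_one_ne
  have e01 := h01.symm
  have e02 := h02.symm
  have e12 := h12.symm
  -- The empty graph is kept opaque, to prevent simplification of the graphs built from it.
  obtain ⟨B, hB⟩ : ∃ B : SimpleGraph (Vertex 1), B = ⊥ := ⟨_, rfl⟩
  have hBr : rank B = 0 := by rw [hB, rank_bot]
  have hBn : B.edgeSet.ncard = 0 := by simp [hB]
  have hBadj : ∀ a b, ¬ B.Adj a b := by simp [hB]
  have hBreach : ∀ a b, B.Reachable a b ↔ a = b := by simp [hB]
  have hG := Gamma_one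
  rw [← hB] at hG
  have hr : rank (Gamma 1) = 2 := by
    rw [hG]
    simp [rank_sup_edge, reachable_sup_edge, hBr, hBreach, h01, h02, h12, e01]
  have hsum : ∀ g : SimpleGraph (Vertex 1) → MvPolynomial (Fin 2) ℤ,
      ∑ A ∈ spanningSubgraphs (Gamma 1), g A = _ := fun g => by
    rw [hG, sum_spanningSubgraphs_sup_edge _ h12, sum_spanningSubgraphs_sup_edge _ h02,
      sum_spanningSubgraphs_sup_edge _ h01, hB, spanningSubgraphs_bot, Finset.sum_singleton,
      ← hB]
    · exact hBadj _ _
    · simp [SimpleGraph.edge_adj, hBadj, h02, e02, e12]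
    · simp [SimpleGraph.edge_adj, hBadj, h12, e02, e12, e01]
  funext t
  rw [gammaSum, patternSum, Finset.sum_filter, hsum]
  simp only [pattern_eq_iff, hasPattern_iff, weight, nullity, hr]
  fin_cases t <;>
    simp +decide [-SimpleGraph.edgeSet_sup, rank_sup_edge, reachable_sup_edge,
      ncard_edgeSet_sup_edge, SimpleGraph.edge_adj, hBr, hBn, hBadj, hBreach,
      h01, h02, h12, e01, e02, e12, related]
  ring

end Sierpinski

/-! ### Symmetry, divisibility and evaluation at `(2, 0)`. -/

section Sierpinski

theorem X_sub_one_ne_zero : (X 0 - 1 : MvPolynomial (Fin 2) ℤ) ≠ 0 := by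
  intro h
  have := congrArg (eval ![2, 0]) h
  simp at this

theorem eq_of_forall_succ {R : Type*} {w : Fin 5 → R}
    (h : ∀ c : Fin 3, w c.succ.castSucc = w (2 : Fin 3).succ.castSucc) :
    w = ![w 0, w 3, w 3, w 3, w 4] := by
  funext t
  fin_cases t
  · rfl
  · exact h 0
  · exact h 1
  · rfl
  · rfl

/-- The generating functions are symmetric in the corners. -/
theorem gammaSum_eq (k : ℕ) : gammaSum (k + 1) = ![gammaSum (k + 1) 0, gammaSum (k + 1) 3,
    gammaSum (k + 1) 3, gammaSum (k + 1) 3, gammaSum (k + 1) 4] := by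
  induction k with
  | zero =>
    refine eq_of_forall_succ fun c => ?_
    rw [zero_add, gammaSum_one]
    fin_cases c <;> rfl
  | succ k ih =>
    refine eq_of_forall_succ fun c => ?_
    apply mul_left_cancel₀ X_sub_one_ne_zero
    rw [gammaSum_succ, gammaSum_succ, ih, gluedSum_succ, gluedSum_succ]

theorem hasPattern_zero_iff {V : Type*} {c : Fin 3 → V} {A : SimpleGraph V} :
    (∀ i j : Fin 3, A.Reachable (c i) (c j)) ↔ HasPattern c A 0 := by
  simp [HasPattern, related]

theorem hasPattern_succ_iff {V : Type*} {c : Fin 3 → V} {A : SimpleGraph V} (d : Fin 3) :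
    ((∀ i j : Fin 3, i ≠ d → j ≠ d → A.Reachable (c i) (c j)) ∧
      ∀ i : Fin 3, i ≠ d → ¬ A.Reachable (c i) (c d)) ↔ HasPattern c A d.succ.castSucc := by
  have h1 := SimpleGraph.reachable_comm (G := A) (u := c 1) (v := c 0)
  have h2 := SimpleGraph.reachable_comm (G := A) (u := c 2) (v := c 0)
  have h3 := SimpleGraph.reachable_comm (G := A) (u := c 2) (v := c 1)
  rw [hasPattern_iff]
  fin_cases d <;> simp [Fin.forall_fin_succ, related, h1, h2, h3] <;> tauto

theorem hasPattern_four_iff {V : Type*} {c : Fin 3 → V} {A : SimpleGraph V} :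
    (∀ i j : Fin 3, i ≠ j → ¬ A.Reachable (c i) (c j)) ↔ HasPattern c A 4 := by
  have h1 := SimpleGraph.reachable_comm (G := A) (u := c 1) (v := c 0)
  have h2 := SimpleGraph.reachable_comm (G := A) (u := c 2) (v := c 0)
  have h3 := SimpleGraph.reachable_comm (G := A) (u := c 2) (v := c 1)
  rw [hasPattern_iff]
  simp [Fin.forall_fin_succ, related, h1, h2, h3]
  tauto

theorem T_eq (n : ℕ) : T n = ∑ t, gammaSum n t := (sum_patternSum _ _).symm

theorem T2_eq (n : ℕ) : T2 n = gammaSum n 0 := by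
  refine Finset.sum_congr ?_ fun _ _ => rfl
  ext A
  simp only [D2, Finset.mem_filter, pattern_eq_iff, hasPattern_zero_iff]

theorem T1_eq (n : ℕ) (c : Fin 3) : T1 n c = gammaSum n c.succ.castSucc := by
  refine Finset.sum_congr ?_ fun _ _ => rfl
  ext A
  simp only [D1, Finset.mem_filter, pattern_eq_iff, hasPattern_succ_iff]

theorem T0_eq (n : ℕ) : T0 n = gammaSum n 4 := by
  refine Finset.sum_congr ?_ fun _ _ => rfl
  ext A
  simp only [D0, Finset.mem_filter, pattern_eq_iff, hasPattern_four_iff]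

theorem X_sub_one_pow_dvd_patternSum {V : Type*} [Fintype V] {c : Fin 3 → V}
    {G : SimpleGraph V} {t : Fin 5} {m : ℕ}
    (h : ∀ A ≤ G, HasPattern c A t → rank A + m ≤ rank G) :
    (X 0 - 1) ^ m ∣ patternSum c G t := by
  refine Finset.dvd_sum fun A hA => ?_
  rw [Finset.mem_filter, mem_spanningSubgraphs, pattern_eq_iff] at hA
  have := h A hA.1 hA.2
  exact Dvd.dvd.mul_right (pow_dvd_pow _ (by omega)) _

/-- Joining two corners by an extra edge raises the rank of `A` but not that of `Γ_n`, so the corank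
of `A` is positive. For three separate corners two extra edges serve in the same way. -/
theorem X_sub_one_dvd_gammaSum (k : ℕ) : (X 0 - 1) ∣ gammaSum (k + 1) 3 := by
  rw [← pow_one (X 0 - 1)]
  refine X_sub_one_pow_dvd_patternSum fun A hA h => ?_
  have h02 : ¬ A.Reachable (corner (k + 1) 0) (corner (k + 1) 2) := by
    rw [h]
    decide
  rw [← rank_sup_edge_of_not_reachable h02,
    ← rank_sup_edge_of_reachable (reachable_corner_Gamma k 0 2)]
  exact rank_mono (sup_le_sup_right hA _)

theorem X_sub_one_sq_dvd_gammaSum (k : ℕ) : (X 0 - 1) ^ 2 ∣ gammaSum (k + 1) 4 := by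
  refine X_sub_one_pow_dvd_patternSum fun A hA h => ?_
  have h01 : ¬ A.Reachable (corner (k + 1) 0) (corner (k + 1) 1) := by
    rw [h]
    decide
  have h02 : ¬ A.Reachable (corner (k + 1) 0) (corner (k + 1) 2) := by
    rw [h]
    decide
  have h12 : ¬ A.Reachable (corner (k + 1) 1) (corner (k + 1) 2) := by
    rw [h]
    decide
  have h02' : ¬ (A ⊔ SimpleGraph.edge (corner (k + 1) 0) (corner (k + 1) 1)).Reachable
      (corner (k + 1) 0) (corner (k + 1) 2) := by
    rw [reachable_sup_edge]
    tauto
  rw [show rank A + 2 = rank A + 1 + 1 from rfl, ← rank_sup_edge_of_not_reachable h01,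
    ← rank_sup_edge_of_not_reachable h02',
    ← rank_sup_edge_of_reachable (reachable_corner_Gamma k 0 1),
    ← rank_sup_edge_of_reachable ((reachable_corner_Gamma k 0 2).mono le_sup_left)]
  exact rank_mono (sup_le_sup_right (sup_le_sup_right hA _) _)

theorem mul_exactQuotient {p d : MvPolynomial (Fin 2) ℤ} (h : d ∣ p) :
    p = d * exactQuotient p d := by
  rw [exactQuotient, dif_pos h]
  exact h.choose_spec

theorem T1_eq_mul_N (k : ℕ) (c : Fin 3) : T1 (k + 1) c = (X 0 - 1) * N (k + 1) := by
  have h : T1 (k + 1) 2 = gammaSum (k + 1) 3 := T1_eq _ _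
  rw [N, ← mul_exactQuotient (h ▸ X_sub_one_dvd_gammaSum k), h, T1_eq, gammaSum_eq]
  fin_cases c <;> rfl

theorem T0_eq_mul_M (k : ℕ) : T0 (k + 1) = (X 0 - 1) ^ 2 * M (k + 1) := by
  rw [M]
  refine mul_exactQuotient ?_
  rw [T0_eq]
  exact X_sub_one_sq_dvd_gammaSum k

theorem at20_gammaSum (k : ℕ) : (fun t => at20 (gammaSum (k + 1) t)) =
    ![at20 (T2 (k + 1)), at20 (N (k + 1)), at20 (N (k + 1)), at20 (N (k + 1)),
      at20 (M (k + 1))] := by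
  have hN : ∀ c, at20 (T1 (k + 1) c) = at20 (N (k + 1)) := fun c => by
    rw [T1_eq_mul_N]
    simp [at20]
  have hM : at20 (T0 (k + 1)) = at20 (M (k + 1)) := by
    rw [T0_eq_mul_M]
    simp [at20]
  rw [← hM, T0_eq, T2_eq]
  funext t
  fin_cases t
  · rfl
  · exact (congrArg at20 (T1_eq _ 0)).symm.trans (hN 0)
  · exact (congrArg at20 (T1_eq _ 1)).symm.trans (hN 1)
  · exact (congrArg at20 (T1_eq _ 2)).symm.trans (hN 2)
  · rfl

/-- At `(2, 0)` the factor `x - 1` is `1`, so nothing needs to be divided out, and `(x - 1)(y - 1)`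
is `-1`. -/
theorem at20_gammaSum_succ (k : ℕ) (t : Fin 5) : at20 (gammaSum (k + 2) t) =
    gluedSum (-1) ![at20 (T2 (k + 1)), at20 (N (k + 1)), at20 (N (k + 1)), at20 (N (k + 1)),
      at20 (M (k + 1))] t := by
  have h := congrArg at20 (gammaSum_succ k t)
  rw [← at20_gammaSum]
  simpa [at20, gluedSum, apply_ite (eval ![(2 : ℤ), 0])] using h

theorem at20_T (k : ℕ) :
    at20 (T (k + 1)) = at20 (T2 (k + 1)) + 3 * at20 (N (k + 1)) + at20 (M (k + 1)) := by
  have h : at20 (T (k + 1)) = ∑ t, at20 (gammaSum (k + 1) t) := by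
    rw [T_eq]
    exact map_sum (eval ![(2 : ℤ), 0]) _ _
  have h' := congrFun (at20_gammaSum k)
  rw [h, Finset.sum_congr rfl fun t _ => h' t]
  simp only [Fin.sum_univ_five, Matrix.cons_val]
  ring

end Sierpinski

end SierpinskiTutte

/-! ### The proposition. -/

open SierpinskiTutte in
theorem proposition3p8 :
    -- `N_n` and `M_n` are the polynomials with
    -- `T_(1,n) = (x - 1) N_n` and `T_(0,n) = (x - 1)² M_n`
    (∀ n : ℕ, 1 ≤ n →
      (∀ c : Fin 3, T1 n c = (MvPolynomial.X 0 - 1) * N n) ∧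
      T0 n = (MvPolynomial.X 0 - 1) ^ 2 * M n) ∧
    -- the number of acyclic orientations
    (∀ n : ℕ, 1 ≤ n → (numAcyclicOrientations (Gamma n) : ℤ) = at20 (T n)) ∧
    -- the recursions
    (∀ n : ℕ, 1 ≤ n →
      at20 (T (n + 1)) = at20 (T n) ^ 3 - 2 * (at20 (T2 n) + at20 (N n)) ^ 3 ∧
      at20 (T2 (n + 1)) =
        -at20 (T2 n) ^ 3 + 6 * at20 (T2 n) ^ 2 * at20 (N n)
          + 3 * at20 (T2 n) * at20 (N n) ^ 2 ∧
      at20 (N (n + 1)) =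
        -at20 (T2 n) ^ 2 * at20 (N n) + at20 (T2 n) ^ 2 * at20 (M n)
          + 7 * at20 (T2 n) * at20 (N n) ^ 2
          + 2 * at20 (T2 n) * at20 (N n) * at20 (M n)
          + 4 * at20 (N n) ^ 3 + at20 (N n) ^ 2 * at20 (M n) ∧
      at20 (M (n + 1)) =
        -3 * at20 (T2 n) * at20 (N n) ^ 2
          + 12 * at20 (T2 n) * at20 (N n) * at20 (M n)
          + 3 * at20 (T2 n) * at20 (M n) ^ 2
          + 13 * at20 (N n) ^ 3 + 24 * at20 (N n) ^ 2 * at20 (M n)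
          + 9 * at20 (N n) * at20 (M n) ^ 2 + at20 (M n) ^ 3) ∧
    -- the initial conditions
    at20 (T2 1) = 2 ∧ at20 (N 1) = 1 ∧ at20 (M 1) = 1 := by
  have h0 (k : ℕ) := at20_gammaSum_succ k 0
  have h1 (k : ℕ) := at20_gammaSum_succ k (2 : Fin 3).succ.castSucc
  have h4 (k : ℕ) := at20_gammaSum_succ k 4
  have hv (k : ℕ) := congrFun (at20_gammaSum k)
  have e1 (k : ℕ) : at20 (gammaSum (k + 1) (2 : Fin 3).succ.castSucc) = at20 (N (k + 1)) := hv k 3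
  have e4 (k : ℕ) : at20 (gammaSum (k + 1) 4) = at20 (M (k + 1)) := hv k 4
  simp only [gluedSum_zero, ← T2_eq] at h0
  simp only [gluedSum_succ, e1] at h1
  simp only [gluedSum_four, e4] at h4
  refine ⟨fun n hn => ?_, fun n _ => numAcyclicOrientations_eq _, fun n hn => ?_, ?_, ?_, ?_⟩
  · obtain ⟨k, rfl⟩ := Nat.exists_eq_add_of_le' hn
    exact ⟨T1_eq_mul_N k, T0_eq_mul_M k⟩
  · obtain ⟨k, rfl⟩ := Nat.exists_eq_add_of_le' hn
    refine ⟨?_, ?_, ?_, ?_⟩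
    · rw [at20_T, at20_T, h0, h1, h4]
      ring
    · rw [h0]
      ring
    · rw [h1]
      ring
    · rw [h4]
      ring
  · rw [T2_eq, gammaSum_one]
    simp [at20]
  · rw [← e1 0, zero_add, gammaSum_one]
    simp [at20]
  · rw [← e4 0, zero_add, gammaSum_one]
    simp [at20]
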